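/- Let $a,d,c$ be positive integers, let $k\ge 2$ be an integer, and let $\mathcal S=\langle a,a+d,\dots,a+kd,c\rangle\subseteq\mathbb Z$ be the set of all non-negative integer linear combinations of $a,a+d,\dots,a+kd,c$. Call $\mathcal S$ pseudo-symmetric if there is a largest integer $g$ not in $\mathcal S$, $g$ is even, and $\mathcal S\cup(g-\mathcal S)=\mathbb Z\setminus\{g/2\}$. If $\gcd(a,d)=1$, put $s_{-1}=a$ and let $s_0$ be the integer with $ds_0\equiv c \pmod a$ and $0\le s_0<a$. As long as $s_i\neq 0$ (for $i=0,1,\dots$) let $q_{i+1},s_{i+1}$ be the integers with $s_{i-1}=q_{i+1}s_i-s_{i+1}$ and $0\le s_{i+1}<s_i$, and let $m\ge -1$ be the index with $s_{m+1}=0$, at which this stops. Put $P_{-1}=0$, $P_0=1$, $P_{i+1}=q_{i+1}P_i-P_{i-1}$ for $0\le i\le m$, and $R_i=\frac1a\left((a+kd)s_i-kcP_i\right)$ for $-1\le i\le m+1$. Let $v$ be the unique index with $-1\le v\le m$ and $R_{v+1}\le 0<R_v$. Then $\mathcal S$ is pseudo-symmetric if and only if $\gcd(a,d)=1$ and one of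 the following statements holds: (a) $\mathcal S=\langle 3,3+d,3+2d\rangle$; (b) $a(c-1)=2(c+d)$ and $c$ is odd; (c) $s_v\equiv 3\pmod k$, $s_{v+1}=1$, $P_{v+1}=P_v+1$ and $R_v=3$; (d) $s_v\equiv 1\pmod k$, $s_{v+1}=2k-1$, $P_{v+1}=P_v+1$ and $R_v=1$; (e) $s_0\neq 0$ (so that $s_1$ and $R_1$ are defined), $s_0\equiv 2\pmod k$, $s_0=s_1+1$ and $R_1=1-2k$; (f) $s_0\neq 0$, $s_0\equiv 2\pmod k$, $s_0=s_1+3$ and $R_1=-1$. -/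

import Mathlib

namespace AASemigroup

/-- The semigroup `⟨a, a + d, …, a + k d, c⟩`, as a set of integers. -/
def aaSemigroup (a d k c : ℕ) : AddSubmonoid ℤ :=
  AddSubmonoid.closure ({x : ℤ | ∃ i : ℕ, i ≤ k ∧ x = (a : ℤ) + i * d} ∪ {(c : ℤ)})

/-- `g` is the Frobenius number of `S`: the largest integer that is not in `S`. -/
def IsFrobenius (S : AddSubmonoid ℤ) (g : ℤ) : Prop :=
  IsGreatest {x : ℤ | x ∉ S} g

/-- `S` has a Frobenius number `g`, which is even, and `S ∪ (g - S) = ℤ \ {g / 2}`. -/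
def IsPseudoSymmetric (S : AddSubmonoid ℤ) : Prop :=
  ∃ g : ℤ, IsFrobenius S g ∧ Even g ∧
    (S : Set ℤ) ∪ {x : ℤ | ∃ s ∈ S, x = g - s} = Set.univ \ {g / 2}

/-- For `a` positive and prime to `d`: the integer `s₀` with `d s₀ ≡ c (mod a)`, `0 ≤ s₀ < a`. -/
def sZero (a d c : ℕ) : ℕ := ((c : ZMod a) * (d : ZMod a)⁻¹).val

theorem sZero_lt (a d c : ℕ) (ha : 0 < a) : sZero a d c < a := by
  have : NeZero a := ⟨ha.ne'⟩
  exact ZMod.val_lt _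

theorem sZero_modEq (a d c : ℕ) (ha : 0 < a) (h : Nat.Coprime a d) :
    d * sZero a d c ≡ c [MOD a] := by
  have : NeZero a := ⟨ha.ne'⟩
  rw [← ZMod.natCast_eq_natCast_iff]
  simp only [sZero, Nat.cast_mul, ZMod.natCast_val, ZMod.cast_id', id]
  rw [mul_left_comm, ZMod.coe_mul_inv_eq_one d h.symm, mul_one]

/-- The remainders of the Euclidean algorithm with negative remainders, with the index shifted
by one: `sSeq a d c n` is `s_{n-1}`. The remainder of `s_{i-1} = q s_i - s_{i+1}` with
`0 ≤ s_{i+1} < s_i` is `(-s_{i-1}) mod s_i`. Only the terms up to the first zero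
among `s₀, s₁, …` are meaningful. -/
def sSeq (a d c : ℕ) : ℕ → ℤ
  | 0 => a
  | 1 => sZero a d c
  | n + 2 => (-sSeq a d c n) % sSeq a d c (n + 1)

/-- The quotients: `qSeq a d c n` is `q_{n+1}`, so that `s_{n-1} = q_{n+1} s_n - s_{n+1}`. -/
def qSeq (a d c : ℕ) (n : ℕ) : ℤ := -((-sSeq a d c n) / sSeq a d c (n + 1))

theorem sSeq_eq (a d c n : ℕ) :
    sSeq a d c n = qSeq a d c n * sSeq a d c (n + 1) - sSeq a d c (n + 2) := by
  have h := Int.mul_ediv_add_emod (-sSeq a d c n) (sSeq a d c (n + 1))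
  rw [qSeq, sSeq]
  linarith

/-- `pSeq a d c n` is `P_{n-1}`: `P_{-1} = 0`, `P₀ = 1`, `P_{i+1} = q_{i+1} P_i - P_{i-1}`. -/
def pSeq (a d c : ℕ) : ℕ → ℤ
  | 0 => 0
  | 1 => 1
  | n + 2 => qSeq a d c n * pSeq a d c (n + 1) - pSeq a d c n

theorem exists_sSeq_eq_zero (a d c : ℕ) (ha : 0 < a) : ∃ n : ℕ, sSeq a d c (n + 1) = 0 := by
  by_contra! hne
  have key : ∀ n : ℕ, 0 < sSeq a d c (n + 1) ∧ sSeq a d c (n + 1) + (n + 1) ≤ a := by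
    intro n
    induction n with
    | zero =>
      have h0 := hne 0
      have h1 := sZero_lt a d c ha
      simp only [sSeq] at h0 ⊢
      push_cast
      omega
    | succ n ih =>
      have h0 := hne (n + 1)
      have h1 := Int.emod_nonneg (-sSeq a d c n) ih.1.ne'
      have h2 := Int.emod_lt_of_pos (-sSeq a d c n) ih.1
      have h3 : sSeq a d c (n + 1 + 1) = (-sSeq a d c n) % sSeq a d c (n + 1) := by rw [sSeq]
      push_cast
      omega
  have := key a
  omega

/-- The index `m ≥ -1` at which the algorithm stops: `s_{m+1}` is the first zero
among `s₀, s₁, …`. -/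
noncomputable def lastIndex (a d c : ℕ) : ℤ :=
  ((sInf {n : ℕ | sSeq a d c (n + 1) = 0} : ℕ) : ℤ) - 1

/-- `s_i` for `-1 ≤ i ≤ m + 1`. -/
def s (a d c : ℕ) (i : ℤ) : ℤ := sSeq a d c (i + 1).toNat

/-- `P_i` for `-1 ≤ i ≤ m + 1`. -/
def P (a d c : ℕ) (i : ℤ) : ℤ := pSeq a d c (i + 1).toNat

/-- `R_i = ((a + k d) s_i - k c P_i) / a` for `-1 ≤ i ≤ m + 1`. -/
def R (a d k c : ℕ) (i : ℤ) : ℚ :=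
  (((a : ℚ) + k * d) * s a d c i - k * c * P a d c i) / a

/-- `v` is the index with `-1 ≤ v ≤ m` and `R_{v+1} ≤ 0 < R_v`. -/
def IsRodsethIndex (a d k c : ℕ) (v : ℤ) : Prop :=
  -1 ≤ v ∧ v ≤ lastIndex a d c ∧ R a d k c (v + 1) ≤ 0 ∧ 0 < R a d k c v

end AASemigroup

/-! Elements of the semigroup are `a n + d y + c z` with `0 ≤ y ≤ k n` and `0 ≤ z`; for fixed `(y,
z)` the least of them is `weight`, that is `a⌈y/k⌉ + d y + c z`. If `a` and `d` are coprime,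
residues mod `a` are classes of points `(y, z)` modulo the lattice `a ∣ d y + c z`, which is
generated by `(s_v, -P_v)` and `(s_{v+1}, -P_{v+1})`. Because `R` changes sign between `v` and `v +
1`, moves by these vectors bring every point of the quadrant into an L-shape without raising its
weight, and the L-shape meets each class exactly once. So its weights form the Apéry set with
respect to `a` (`LShape.mem_iff`).

Pseudo-symmetry then says that, with `W = g + a`, the map `w ↦ W - w` permutes the Apéry set apart
from one element `w₀ = g/2 + a`, for which `2 w₀ = W + a` (`exists_corner`,
`isPseudoSymmetric_of_pairing`). `W` is attained at one of the two outer corners. The L-shape is the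
rectangle below that corner together with a remaining rectangle, and the pairing acts on each by a
point reflection, so everything becomes an identity between ceilings. Apart from a row of three
points, `w₀` must be the centre of the remaining rectangle, where the sum of ceilings is one larger
than at all other points. Comparing the centre with its column, its neighbours and the points at
distance `k` leaves a short list (`shape_of_isPseudoSymmetric`), and each entry of the list can be
checked directly.

Coprimality of `a` and `d` is proved separately (`IsPseudoSymmetric.eq_one_of_dvd`). -/

namespace AASemigroup

/-! ### Integer ceilings -/

/-- `⌈y / k⌉` for integers. -/
def ceilDiv (k y : ℤ) : ℤ := -((-y) / k)

theorem le_mul_ceilDiv {k : ℤ} (hk : 0 < k) (y : ℤ) : y ≤ k * ceilDiv k y := by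
  have := Int.mul_ediv_self_le (x := -y) hk.ne'
  unfold ceilDiv
  linarith

theorem ceilDiv_le {k y m : ℤ} (hk : 0 < k) (h : y ≤ k * m) : ceilDiv k y ≤ m := by
  have : -m ≤ (-y) / k := (Int.le_ediv_iff_mul_le hk).2 (by linarith)
  unfold ceilDiv
  linarith

theorem ceilDiv_eq {k y m : ℤ} (hk : 0 < k) (h : y ≤ k * m) (h' : k * (m - 1) < y) :
    ceilDiv k y = m := by
  refine le_antisymm (ceilDiv_le hk h) ?_
  have h1 := le_mul_ceilDiv hk y
  have : k * (m - 1) < k * ceilDiv k y := lt_of_lt_of_le h' h1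
  have := lt_of_mul_lt_mul_left this hk.le
  linarith

theorem mul_ceilDiv_lt {k : ℤ} (hk : 0 < k) (y : ℤ) : k * (ceilDiv k y - 1) < y := by
  by_contra! h
  have := ceilDiv_le hk h
  linarith

theorem ceilDiv_zero (k : ℤ) : ceilDiv k 0 = 0 := by simp [ceilDiv]

theorem ceilDiv_mono {k x y : ℤ} (hk : 0 < k) (h : x ≤ y) : ceilDiv k x ≤ ceilDiv k y :=
  ceilDiv_le hk (h.trans (le_mul_ceilDiv hk y))

/-! ### The L-shape as a set of representatives -/

/-- Integers `s, s', p, p'` such that `(s, -p')` and `(s', -p)` generate the lattice of all `(y, z)`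
with `a ∣ d y + c z`, in the position of two consecutive vectors of Rødseth's algorithm between
which the sign of `R` changes. -/
structure LShape (a d k c s s' p p' t t' : ℤ) : Prop where
  a_pos : 0 < a
  d_pos : 0 < d
  k_two : 2 ≤ k
  c_pos : 0 < c
  coprime : IsCoprime a d
  s'_nonneg : 0 ≤ s'
  s'_lt : s' < s
  p'_nonneg : 0 ≤ p'
  p'_lt : p' < p
  det : s * p - s' * p' = a
  row : d * s - c * p' = a * t
  row' : d * s' - c * p = a * t'
  nonpos : k * t' + s' ≤ 0
  pos : 0 < k * t + s

/-- The smallest element of the semigroup of the form `a n + d y + c z`. -/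
def weight (a d k c y z : ℤ) : ℤ := a * ceilDiv k y + d * y + c * z

/-- The lattice points of the L-shape that parametrizes the Apéry set. -/
def InShape (s s' p p' y z : ℤ) : Prop :=
  0 ≤ y ∧ 0 ≤ z ∧ (y < s - s' ∧ z < p ∨ y < s ∧ z < p - p')

theorem weight_mono {a d k c y z y' z' : ℤ} (ha : 0 < a) (hd : 0 < d) (hk : 0 < k) (hc : 0 < c)
    (hy : y ≤ y') (hz : z ≤ z') : weight a d k c y z ≤ weight a d k c y' z' := by
  have := ceilDiv_mono hk hy
  unfold weight
  gcongr

namespace LShape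

variable {a d k c s s' p p' t t' : ℤ}

theorem k_pos (h : LShape a d k c s s' p p' t t') : 0 < k := by linarith [h.k_two]

/-- The linear form `(a + k d) y + k c z` does not grow when `(s', -p)` is added and drops when `(s,
-p')` is subtracted. The induction is on this form, with `z` breaking ties; the factor `p + 1`
outweighs the growth of `z` by `p'` in the second move. -/
theorem exists_inShape_aux (h : LShape a d k c s s' p p' t t') (n : ℕ) :
    ∀ y z : ℤ, 0 ≤ y → 0 ≤ z → (p + 1) * ((a + k * d) * y + k * c * z) + z < n →
      ∃ y' z', InShape s s' p p' y' z' ∧ weight a d k c y' z' ≤ weight a d k c y z ∧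
        a ∣ weight a d k c y z - weight a d k c y' z' := by
  have ha := h.a_pos
  have hd := h.d_pos
  have hk := h.k_pos
  have hc := h.c_pos
  have hs := h.s'_lt
  have hs' := h.s'_nonneg
  have hp := h.p'_lt
  have hp' := h.p'_nonneg
  have hR := h.pos
  have hR' := h.nonpos
  have row := h.row
  have row' := h.row'
  induction n with
  | zero =>
    intro y z hy hz hlt
    exfalso
    have : 0 ≤ (p + 1) * ((a + k * d) * y + k * c * z) + z := by
      have : 0 ≤ p + 1 := by linarith
      positivity
    push_cast at hlt
    linarith
  | succ n ih =>
    intro y z hy hz hlt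
    push_cast at hlt
    have hy1 := le_mul_ceilDiv hk y
    -- a move by a lattice vector reduces to the induction hypothesis
    have step : ∀ y₁ z₁ τ : ℤ, 0 ≤ y₁ → 0 ≤ z₁ → d * (y₁ - y) + c * (z₁ - z) = a * τ →
        y₁ ≤ k * (ceilDiv k y - τ) →
        (p + 1) * ((a + k * d) * (y₁ - y) + k * c * (z₁ - z)) + (z₁ - z) < 0 →
        ∃ y' z', InShape s s' p p' y' z' ∧ weight a d k c y' z' ≤ weight a d k c y z ∧
          a ∣ weight a d k c y z - weight a d k c y' z' := by
      intro y₁ z₁ τ hy₁ hz₁ hτ hle hdec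
      obtain ⟨y', z', hin, hw, hdvd⟩ := ih y₁ z₁ hy₁ hz₁ (by linarith)
      have hce := ceilDiv_le hk hle
      have e : weight a d k c y z - weight a d k c y₁ z₁ =
          a * (ceilDiv k y - τ - ceilDiv k y₁) := by
        unfold weight
        linear_combination -hτ
      refine ⟨y', z', hin, hw.trans ?_, ?_⟩
      · have : 0 ≤ a * (ceilDiv k y - τ - ceilDiv k y₁) :=
          mul_nonneg ha.le (by linarith)
        linarith
      · have := dvd_add (Dvd.intro _ e.symm) hdvd
        simpa using this
    by_cases hzp : p ≤ z
    · refine step (y + s') (z - p) t' (by linarith) (by linarith) (by linarith) ?_ ?_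
      · linarith
      · have : (a + k * d) * (y + s' - y) + k * c * (z - p - z) = a * (k * t' + s') := by
          linear_combination k * row'
        rw [this]
        have : (p + 1) * (a * (k * t' + s')) ≤ 0 :=
          mul_nonpos_of_nonneg_of_nonpos (by linarith)
            (mul_nonpos_of_nonneg_of_nonpos ha.le hR')
        linarith
    by_cases hys : s ≤ y
    · refine step (y - s) (z + p') (-t) (by linarith) (by linarith) (by linarith) ?_ ?_
      · linarith
      · have : (a + k * d) * (y - s - y) + k * c * (z + p' - z) = -(a * (k * t + s)) := by
          linear_combination -k * row
        rw [this]
        have : 1 ≤ a * (k * t + s) := Int.add_one_le_iff.2 (mul_pos ha hR)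
        nlinarith
    by_cases hin : InShape s s' p p' y z
    · exact ⟨y, z, hin, le_rfl, by simp⟩
    · have h1 : s - s' ≤ y := by
        by_contra! h1
        exact hin ⟨hy, hz, Or.inl ⟨h1, by linarith⟩⟩
      have h2 : p - p' ≤ z := by
        by_contra! h2
        exact hin ⟨hy, hz, Or.inr ⟨by linarith, h2⟩⟩
      refine step (y - s + s') (z - p + p') (t' - t) (by linarith) (by linarith) (by linarith)
        ?_ ?_
      · linarith
      · have : (a + k * d) * (y - s + s' - y) + k * c * (z - p + p' - z) =
            a * (k * t' + s') - a * (k * t + s) := by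
          linear_combination k * row' - k * row
        rw [this]
        have h3 : 0 < a * (k * t + s) := mul_pos ha hR
        have h4 : a * (k * t' + s') ≤ 0 := mul_nonpos_of_nonneg_of_nonpos ha.le hR'
        have : (p + 1) * (a * (k * t' + s') - a * (k * t + s)) ≤ 0 :=
          mul_nonpos_of_nonneg_of_nonpos (by linarith) (by linarith)
        linarith

theorem exists_inShape (h : LShape a d k c s s' p p' t t') {y z : ℤ} (hy : 0 ≤ y) (hz : 0 ≤ z) :
    ∃ y' z', InShape s s' p p' y' z' ∧ weight a d k c y' z' ≤ weight a d k c y z ∧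
      a ∣ weight a d k c y z - weight a d k c y' z' :=
  h.exists_inShape_aux (((p + 1) * ((a + k * d) * y + k * c * z) + z).toNat + 1) y z hy hz
    (by push_cast; linarith [Int.self_le_toNat ((p + 1) * ((a + k * d) * y + k * c * z) + z)])

/-- Points of the L-shape differ by less than `s` in `y` and less than `p` in `z`, which excludes
nonzero combinations except those with `β = -α`. In that case one point exceeds the other by at
least `(s - s', p - p')`, so it would lie in the notch. -/
theorem inShape_diff (h : LShape a d k c s s' p p' t t') {y z y' z' : ℤ}
    (hu : InShape s s' p p' y z) (hu' : InShape s s' p p' y' z') {α β : ℤ}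
    (hy : y - y' = α * s + β * s') (hz : z - z' = -(α * p') - β * p) (hα : 0 ≤ α) :
    y = y' ∧ z = z' := by
  have hs := h.s'_lt
  have hs' := h.s'_nonneg
  have hp := h.p'_lt
  have hp' := h.p'_nonneg
  obtain ⟨hy0, hz0, hL⟩ := hu
  obtain ⟨hy0', hz0', hL'⟩ := hu'
  have dy : y - y' < s := by rcases hL with h | h <;> linarith
  have dz : z - z' < p := by rcases hL with h | h <;> linarith
  have dz' : z' - z < p := by rcases hL' with h | h <;> linarith
  rcases eq_or_lt_of_le hα with rfl | hα
  · rcases lt_trichotomy β 0 with hβ | rfl | hβ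
    · nlinarith
    · constructor <;> linarith
    · nlinarith
  exfalso
  rcases le_or_gt 0 β with hβ | hβ
  · nlinarith [mul_nonneg hβ hs']
  rcases lt_trichotomy α (-β) with hlt | heq | hlt
  · nlinarith [mul_nonneg (sub_nonneg.2 (Int.add_one_le_iff.2 hlt)) (hp'.trans hp.le),
      mul_pos hα (sub_pos.2 hp)]
  · have e1 : y - y' = α * (s - s') := by rw [hy]; linear_combination s' * heq
    have e2 : z - z' = α * (p - p') := by rw [hz]; linear_combination p * (-heq)
    have h1 : s - s' ≤ y - y' := by rw [e1]; nlinarith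
    have h2 : p - p' ≤ z - z' := by rw [e2]; nlinarith
    rcases hL with h | h <;> linarith
  · nlinarith [mul_nonneg (sub_nonneg.2 (Int.add_one_le_iff.2 hlt)) (hs'.trans hs.le),
      mul_pos (neg_pos.2 hβ) (sub_pos.2 hs)]

theorem inShape_unique (h : LShape a d k c s s' p p' t t') {y z y' z' : ℤ}
    (hu : InShape s s' p p' y z) (hu' : InShape s s' p p' y' z')
    (hdvd : a ∣ d * (y - y') + c * (z - z')) : y = y' ∧ z = z' := by
  obtain ⟨m, hm⟩ := hdvd
  have row := h.row
  have row' := h.row'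
  have det := h.det
  have ha := h.a_pos.ne'
  -- Cramer's rule for the coordinates of the difference in the lattice basis, of determinant `a` up
  -- to sign. Divisibility by `a` holds after multiplication by `d`, which is invertible mod `a`.
  obtain ⟨α, hα⟩ : a ∣ p * (y - y') + s' * (z - z') :=
    h.coprime.dvd_of_dvd_mul_left ⟨p * m + (z - z') * t', by
      linear_combination p * hm + (z - z') * row'⟩
  obtain ⟨β, hβ⟩ : a ∣ -(p' * (y - y') + s * (z - z')) :=
    h.coprime.dvd_of_dvd_mul_left ⟨-(p' * m) - (z - z') * t, by
      linear_combination -p' * hm - (z - z') * row⟩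
  have hy : y - y' = α * s + β * s' := by
    apply mul_left_cancel₀ ha
    linear_combination s * hα + s' * hβ - (y - y') * det
  have hz : z - z' = -(α * p') - β * p := by
    apply mul_left_cancel₀ ha
    linear_combination -p' * hα - p * hβ - (z - z') * det
  rcases le_total 0 α with h0 | h0
  · exact h.inShape_diff hu hu' hy hz h0
  · have := h.inShape_diff hu' hu (α := -α) (β := -β) (by linarith) (by linarith) (by linarith)
    exact ⟨this.1.symm, this.2.symm⟩

theorem weight_inShape_unique (h : LShape a d k c s s' p p' t t') {y z y' z' : ℤ}
    (hu : InShape s s' p p' y z) (hu' : InShape s s' p p' y' z')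
    (hdvd : a ∣ weight a d k c y z - weight a d k c y' z') : y = y' ∧ z = z' := by
  refine h.inShape_unique hu hu' ?_
  obtain ⟨m, hm⟩ := hdvd
  refine ⟨m - (ceilDiv k y - ceilDiv k y'), ?_⟩
  unfold weight at hm
  linarith

theorem exists_residue (h : LShape a d k c s s' p p' t t') (x : ℤ) :
    ∃ y z, InShape s s' p p' y z ∧ a ∣ x - weight a d k c y z := by
  obtain ⟨m, n, hmn⟩ := h.coprime
  have ha := h.a_pos
  have hy : 0 ≤ (n * x) % a := Int.emod_nonneg _ ha.ne'
  obtain ⟨y, z, hu, -, hdvd⟩ := h.exists_inShape hy le_rfl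
  refine ⟨y, z, hu, ?_⟩
  have h1 : a ∣ x - weight a d k c ((n * x) % a) 0 := by
    have h2 := Int.mul_ediv_add_emod (n * x) a
    refine ⟨m * x + d * (n * x / a) - ceilDiv k ((n * x) % a), ?_⟩
    unfold weight
    linear_combination -x * hmn - d * h2
  simpa using dvd_add h1 hdvd

end LShape

/-! ### Membership through the Apéry set -/

/-- `S` consists of the integers `a n + d y + c z` with `0 ≤ y ≤ k n` and `0 ≤ z`. -/
def IsAlmostArithmetic (a d k c : ℤ) (S : AddSubmonoid ℤ) : Prop :=
  ∀ x, x ∈ S ↔ ∃ n y z : ℤ, 0 ≤ y ∧ 0 ≤ z ∧ y ≤ k * n ∧ x = a * n + d * y + c * z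

theorem LShape.mem_iff {a d k c s s' p p' t t' : ℤ} {S : AddSubmonoid ℤ}
    (h : LShape a d k c s s' p p' t t') (hS : IsAlmostArithmetic a d k c S) {x y z : ℤ}
    (hu : InShape s s' p p' y z) (hdvd : a ∣ x - weight a d k c y z) :
    x ∈ S ↔ weight a d k c y z ≤ x := by
  have hk := h.k_pos
  have ha := h.a_pos
  rw [hS]
  constructor
  · rintro ⟨n, y₁, z₁, hy₁, hz₁, hn, rfl⟩
    obtain ⟨y', z', hu', hle, hdvd'⟩ := h.exists_inShape hy₁ hz₁
    have hce := ceilDiv_le hk hn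
    have e : a * n + d * y₁ + c * z₁ - weight a d k c y₁ z₁ = a * (n - ceilDiv k y₁) := by
      unfold weight; ring
    have h1 : a ∣ weight a d k c y' z' - weight a d k c y z := by
      obtain ⟨m, hm⟩ := hdvd
      obtain ⟨m', hm'⟩ := hdvd'
      exact ⟨m - (n - ceilDiv k y₁) - m', by linarith⟩
    obtain ⟨rfl, rfl⟩ := h.weight_inShape_unique hu' hu h1
    have : 0 ≤ a * (n - ceilDiv k y₁) := mul_nonneg ha.le (by linarith)
    linarith
  · intro hle
    obtain ⟨j, hj⟩ := hdvd
    have hj0 : 0 ≤ j := by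
      have : 0 ≤ a * j := by linarith
      exact nonneg_of_mul_nonneg_right this ha
    refine ⟨ceilDiv k y + j, y, z, hu.1, hu.2.1, ?_, ?_⟩
    · have := le_mul_ceilDiv hk y
      have := mul_nonneg hk.le hj0
      linarith
    · unfold weight at hj
      linarith

theorem aaSemigroup_isAlmostArithmetic (a d k c : ℕ) (hk : 0 < k) :
    IsAlmostArithmetic a d k c (aaSemigroup a d k c) := by
  have hk' : (0 : ℤ) < k := by exact_mod_cast hk
  intro x
  constructor
  · intro hx
    induction hx using AddSubmonoid.closure_induction with
    | mem x hx =>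
      rcases hx with ⟨i, hi, rfl⟩ | rfl
      · exact ⟨1, i, 0, by positivity, le_rfl, by simpa using hi, by ring⟩
      · exact ⟨0, 0, 1, le_rfl, zero_le_one, by simp, by ring⟩
    | zero => exact ⟨0, 0, 0, le_rfl, le_rfl, by simp, by ring⟩
    | add x x' _ _ h h' =>
      obtain ⟨n, y, z, hy, hz, hn, rfl⟩ := h
      obtain ⟨n', y', z', hy', hz', hn', rfl⟩ := h'
      exact ⟨n + n', y + y', z + z', by linarith, by linarith, by linarith, by ring⟩
  · rintro ⟨n, y, z, hy, hz, hn, rfl⟩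
    have hn0 : 0 ≤ n := nonneg_of_mul_nonneg_right (hy.trans hn) hk'
    lift n to ℕ using hn0
    lift z to ℕ using hz
    have hcz : (c : ℤ) * z ∈ aaSemigroup a d k c := by
      have : (c : ℤ) ∈ aaSemigroup a d k c := AddSubmonoid.subset_closure (Or.inr rfl)
      simpa [mul_comm] using AddSubmonoid.nsmul_mem _ this z
    refine AddSubmonoid.add_mem _ ?_ hcz
    clear hcz z
    induction n generalizing y with
    | zero =>
      have : y = 0 := le_antisymm (by simpa using hn) hy
      simp [this]
    | succ n ih =>
      lift y to ℕ using hy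
      have hn' : y ≤ k * (n + 1) := by exact_mod_cast hn
      have hgen : (a : ℤ) + (min k y : ℕ) * d ∈ aaSemigroup a d k c :=
        AddSubmonoid.subset_closure (Or.inl ⟨min k y, min_le_left _ _, rfl⟩)
      have hrest := ih (y - (min k y : ℕ)) (by simp) (by
        have : y - min k y ≤ k * n := by
          rw [mul_add] at hn'
          omega
        have h2 : ((y - min k y : ℕ) : ℤ) ≤ k * n := by exact_mod_cast this
        rwa [Nat.cast_sub (min_le_right _ _)] at h2)
      convert AddSubmonoid.add_mem _ hgen hrest using 1
      push_cast
      ring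

/-! ### Pseudo-symmetry as a pairing of the Apéry set -/

namespace LShape

variable {a d k c s s' p p' t t' : ℤ} {S : AddSubmonoid ℤ}

/-- With `g = W - a`, a gap `w - a i`, `i ≥ 1`, is reflected to `w' + a (i - 1)`, where `w + w' =
W`, and this is in `S`. At the exceptional weight `w₀` it is reflected to `w₀ + a (i - 2)`, which
fails to be in `S` only for `i = 1`, at the gap `g / 2`. -/
theorem isPseudoSymmetric_of_pairing (h : LShape a d k c s s' p p' t t')
    (hS : IsAlmostArithmetic a d k c S) {y₀ z₀ W : ℤ} (he : InShape s s' p p' y₀ z₀)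
    (hW : a ≤ W) (h2 : 2 * weight a d k c y₀ z₀ = W + a)
    (hpair : ∀ y z, InShape s s' p p' y z → (y = y₀ ∧ z = z₀) ∨
      ∃ y' z', InShape s s' p p' y' z' ∧ weight a d k c y z + weight a d k c y' z' = W) :
    IsPseudoSymmetric S := by
  have ha := h.a_pos
  have hnonneg : ∀ y z, InShape s s' p p' y z → 0 ≤ weight a d k c y z := by
    intro y z hu
    simpa [weight, ceilDiv_zero] using
      weight_mono (y := 0) (z := 0) ha h.d_pos h.k_pos h.c_pos hu.1 hu.2.1
  have hg : W - a = 2 * (weight a d k c y₀ z₀ - a) := by linarith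
  have hhalf : (W - a) / 2 = weight a d k c y₀ z₀ - a := by omega
  have hhalf_notMem : weight a d k c y₀ z₀ - a ∉ S := by
    rw [h.mem_iff hS he ⟨-1, by ring⟩]
    linarith
  have h00 : InShape s s' p p' 0 0 := by
    have := h.s'_lt
    have := h.p'_lt
    have := h.p'_nonneg
    exact ⟨le_rfl, le_rfl, Or.inl ⟨by linarith, by linarith⟩⟩
  have hw00 : weight a d k c 0 0 = 0 := by simp [weight, ceilDiv_zero]
  have hg_notMem : W - a ∉ S := by
    rcases hpair 0 0 h00 with ⟨rfl, rfl⟩ | ⟨y', z', hu', hsum⟩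
    · linarith
    · rw [h.mem_iff hS hu' ⟨-1, by linarith⟩]
      linarith
  refine ⟨W - a, ⟨hg_notMem, ?_⟩, ⟨weight a d k c y₀ z₀ - a, by linarith⟩, ?_⟩
  · intro x hx
    obtain ⟨y, z, hu, hdvd⟩ := h.exists_residue x
    have hlt : x < weight a d k c y z := by
      by_contra! hle
      exact hx ((h.mem_iff hS hu hdvd).2 hle)
    obtain ⟨j, hj⟩ := hdvd
    have hj0 : j < 0 := by
      by_contra! h0
      have := mul_nonneg ha.le h0
      linarith
    have hxle : x ≤ weight a d k c y z - a := by nlinarith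
    rcases hpair y z hu with ⟨rfl, rfl⟩ | ⟨y', z', hu', hsum⟩
    · linarith
    · linarith [hnonneg y' z' hu']
  · rw [hhalf]
    ext x
    simp only [Set.mem_union, SetLike.mem_coe, Set.mem_ofPred_eq, Set.mem_sdiff, Set.mem_univ,
      Set.mem_singleton_iff, true_and]
    constructor
    · rintro (hx | ⟨σ, hσ, rfl⟩) heq
      · exact hhalf_notMem (heq ▸ hx)
      · apply hhalf_notMem
        convert hσ using 1
        linarith
    · intro hne
      by_cases hx : x ∈ S
      · exact Or.inl hx
      refine Or.inr ⟨W - a - x, ?_, by ring⟩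
      obtain ⟨y, z, hu, hdvd⟩ := h.exists_residue x
      have hlt : x < weight a d k c y z := by
        by_contra! hle
        exact hx ((h.mem_iff hS hu hdvd).2 hle)
      obtain ⟨j, hj⟩ := hdvd
      have hj0 : j ≤ -1 := by
        by_contra! h0
        have := mul_nonneg ha.le (show 0 ≤ j by linarith)
        linarith
      rcases hpair y z hu with ⟨rfl, rfl⟩ | ⟨y', z', hu', hsum⟩
      · have hj1 : j ≤ -2 := by
          by_contra! h0
          obtain rfl : j = -1 := by omega
          exact hne (by linarith)
        rw [h.mem_iff hS he ⟨-j - 2, by linarith⟩]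
        nlinarith
      · rw [h.mem_iff hS hu' ⟨-j - 1, by linarith⟩]
        nlinarith

/-- `weight` is monotone in both coordinates, so its maximum `g + a` is attained at an outer corner.
-/
theorem exists_corner (h : LShape a d k c s s' p p' t t')
    (hS : IsAlmostArithmetic a d k c S) (hps : IsPseudoSymmetric S) :
    ∃ Y Z y₀ z₀ : ℤ, (Y = s - s' - 1 ∧ Z = p - 1 ∨ Y = s - 1 ∧ Z = p - p' - 1) ∧
      InShape s s' p p' y₀ z₀ ∧
      2 * weight a d k c y₀ z₀ = weight a d k c Y Z + a ∧
      a ≤ weight a d k c Y Z ∧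
      ∀ y z y' z', InShape s s' p p' y z → InShape s s' p p' y' z' →
        a ∣ d * (y + y' - Y) + c * (z + z' - Z) →
        weight a d k c y z + weight a d k c y' z' = weight a d k c Y Z ∨
          (y = y₀ ∧ z = z₀ ∧ y' = y₀ ∧ z' = z₀) := by
  obtain ⟨g, ⟨hg, hmax⟩, heven, hunion⟩ := hps
  have ha := h.a_pos
  have hs := h.s'_lt
  have hs' := h.s'_nonneg
  have hp := h.p'_lt
  have hp' := h.p'_nonneg
  have hmem : ∀ y z, InShape s s' p p' y z → weight a d k c y z ∈ S := fun y z hu =>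
    (h.mem_iff hS hu (by simp)).2 le_rfl
  have hnotMem : ∀ y z, InShape s s' p p' y z → weight a d k c y z - a ∉ S := fun y z hu => by
    rw [h.mem_iff hS hu ⟨-1, by ring⟩]
    linarith
  have hcorner : ∃ Y Z, (Y = s - s' - 1 ∧ Z = p - 1 ∨ Y = s - 1 ∧ Z = p - p' - 1) ∧
      InShape s s' p p' Y Z ∧ weight a d k c Y Z = g + a := by
    obtain ⟨y, z, hu, hdvd⟩ := h.exists_residue g
    have h1 : g < weight a d k c y z := by
      by_contra! hle
      exact hg ((h.mem_iff hS hu hdvd).2 hle)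
    have h2 : g + a ∈ S := by
      by_contra hn
      have : g + a ≤ g := hmax hn
      linarith
    obtain ⟨j, hj⟩ := hdvd
    rw [h.mem_iff hS hu ⟨j + 1, by linarith⟩] at h2
    have hj0 : j ≤ -1 := by
      by_contra! h0
      have := mul_nonneg ha.le (show 0 ≤ j by linarith)
      linarith
    have hge : g + a ≤ weight a d k c y z := by nlinarith
    obtain ⟨hy, hz, hL⟩ := hu
    have key : ∀ Y Z, InShape s s' p p' Y Z → y ≤ Y → z ≤ Z → weight a d k c Y Z = g + a := by
      intro Y Z hU hyY hzZ
      have h3 := weight_mono ha h.d_pos h.k_pos h.c_pos hyY hzZ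
      have h4 : weight a d k c Y Z - a ≤ g := hmax (hnotMem Y Z hU)
      linarith
    rcases hL with hL | hL
    · have hU : InShape s s' p p' (s - s' - 1) (p - 1) :=
        ⟨by linarith, by linarith, Or.inl ⟨by linarith, by linarith⟩⟩
      exact ⟨_, _, Or.inl ⟨rfl, rfl⟩, hU, key _ _ hU (by linarith) (by linarith)⟩
    · have hU : InShape s s' p p' (s - 1) (p - p' - 1) :=
        ⟨by linarith, by linarith, Or.inr ⟨by linarith, by linarith⟩⟩
      exact ⟨_, _, Or.inr ⟨rfl, rfl⟩, hU, key _ _ hU (by linarith) (by linarith)⟩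
  obtain ⟨Y, Z, hYZ, -, hW⟩ := hcorner
  obtain ⟨r, hr⟩ := heven
  have hr2 : g / 2 = r := by omega
  rw [hr2] at hunion
  have hiff : ∀ x, (x ∈ S ∨ g - x ∈ S) ↔ x ≠ r := by
    intro x
    have := Set.ext_iff.1 hunion x
    simp only [Set.mem_union, SetLike.mem_coe, Set.mem_ofPred_eq, Set.mem_sdiff, Set.mem_univ,
      Set.mem_singleton_iff, true_and] at this
    rw [ne_eq, ← this]
    refine or_congr_right ⟨fun hx => ⟨_, hx, by ring⟩, ?_⟩
    rintro ⟨σ, hσ, rfl⟩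
    simpa using hσ
  have hrS : r ∉ S := fun hx => (hiff r).1 (Or.inl hx) rfl
  have hg_ge : -1 ≤ g := by
    have : (-1 : ℤ) ∉ S := by
      rw [hS]
      rintro ⟨n, y, z, hy, hz, hn, heq⟩
      have hn0 : 0 ≤ n := nonneg_of_mul_nonneg_right (hy.trans hn) h.k_pos
      have := mul_nonneg ha.le hn0
      have := mul_nonneg h.d_pos.le hy
      have := mul_nonneg h.c_pos.le hz
      linarith
    exact hmax this
  obtain ⟨y₀, z₀, he, hdvd⟩ := h.exists_residue r
  have h2 : weight a d k c y₀ z₀ = r + a := by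
    have hlt : r < weight a d k c y₀ z₀ := by
      by_contra! hle
      exact hrS ((h.mem_iff hS he hdvd).2 hle)
    by_contra hne
    rcases (hiff (weight a d k c y₀ z₀ - a)).2 (fun hh => hne (by linarith)) with hx | hx
    · exact hnotMem _ _ he hx
    · obtain ⟨j, hj⟩ := hdvd
      rw [h.mem_iff hS he ⟨2 * j + 1, by linarith⟩] at hx
      have hj0 : j ≤ -1 := by
        by_contra! h0
        have := mul_nonneg ha.le (show 0 ≤ j by linarith)
        linarith
      have hj1 : j ≠ -1 := by
        rintro rfl
        exact hne (by linarith)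
      have : j ≤ -2 := by omega
      nlinarith
  -- `g` is even and at least `-1`, hence nonnegative; this gives `a ≤ g + a`.
  refine ⟨Y, Z, y₀, z₀, hYZ, he, by linarith, by omega, ?_⟩
  intro y z y' z' hu hu' hdvd'
  obtain ⟨m, hm⟩ : a ∣ weight a d k c Y Z - weight a d k c y z - weight a d k c y' z' := by
    obtain ⟨m, hm⟩ := hdvd'
    refine ⟨ceilDiv k Y - ceilDiv k y - ceilDiv k y' - m, ?_⟩
    unfold weight
    linarith
  by_cases hx : weight a d k c y z - a = r
  · right
    obtain ⟨rfl, rfl⟩ := h.weight_inShape_unique hu he ⟨0, by linarith⟩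
    obtain ⟨rfl, rfl⟩ := h.weight_inShape_unique hu' he ⟨-m - 1, by linarith⟩
    exact ⟨rfl, rfl, rfl, rfl⟩
  · left
    rcases (hiff _).2 hx with hx | hx
    · exact absurd hx (hnotMem _ _ hu)
    · rw [h.mem_iff hS hu' ⟨m, by linarith⟩] at hx
      have hm0 : 0 ≤ m := by
        have : 0 ≤ a * m := by linarith
        exact nonneg_of_mul_nonneg_right this ha
      have hm1 : m ≤ 0 := by
        by_contra! hm1
        apply hg
        have h3 : g - weight a d k c y z ∈ S := by
          rw [h.mem_iff hS hu' ⟨m - 1, by linarith⟩]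
          nlinarith
        have := S.add_mem (hmem _ _ hu) h3
        simpa using this
      obtain rfl : m = 0 := le_antisymm hm1 hm0
      linarith

end LShape

/-! ### Additivity of ceilings and residues mod `k` -/

theorem ceilDiv_one {k : ℤ} (hk : 0 < k) : ceilDiv k 1 = 1 :=
  ceilDiv_eq hk (by linarith) (by linarith)

theorem ceilDiv_two {k : ℤ} (hk : 2 ≤ k) : ceilDiv k 2 = 1 :=
  ceilDiv_eq (by linarith) (by linarith) (by linarith)

theorem ceilDiv_add_ceilDiv_sub {k Y : ℤ} (hk : 0 < k) (hY : Y = 0 ∨ ∃ Q, Y = k * Q + 1) {y : ℤ}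
    (hy : 0 ≤ y) (hyY : y ≤ Y) : ceilDiv k y + ceilDiv k (Y - y) = ceilDiv k Y := by
  rcases hY with rfl | ⟨Q, rfl⟩
  · obtain rfl : y = 0 := le_antisymm hyY hy
    simp [ceilDiv_zero]
  · have h1 := le_mul_ceilDiv hk y
    have h2 := Int.add_one_le_iff.2 (mul_ceilDiv_lt hk y)
    have e1 : ceilDiv k (k * Q + 1) = Q + 1 := ceilDiv_eq hk (by linarith) (by linarith)
    have e2 : ceilDiv k (k * Q + 1 - y) = Q + 1 - ceilDiv k y :=
      ceilDiv_eq hk (by linarith) (by linarith)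
    linarith

theorem eq_mul_add_one_of_ceilDiv {k Y : ℤ} (hk : 0 < k)
    (h : ceilDiv k 1 + ceilDiv k (Y - 1) = ceilDiv k Y) : ∃ Q, Y = k * Q + 1 := by
  rw [ceilDiv_one hk] at h
  have h1 := le_mul_ceilDiv hk (Y - 1)
  have h2 := mul_ceilDiv_lt hk Y
  refine ⟨ceilDiv k (Y - 1), ?_⟩
  rw [← h] at h2
  have : k * (1 + ceilDiv k (Y - 1) - 1) = k * ceilDiv k (Y - 1) := by ring
  linarith

theorem ceilDiv_add_self {k : ℤ} (hk : 0 < k) (y : ℤ) : ceilDiv k (y + k) = ceilDiv k y + 1 := by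
  have h1 := le_mul_ceilDiv hk y
  have h2 := mul_ceilDiv_lt hk y
  exact ceilDiv_eq hk (by linarith) (by linarith)

theorem ceilDiv_sub_self {k : ℤ} (hk : 0 < k) (y : ℤ) : ceilDiv k (y - k) = ceilDiv k y - 1 := by
  have h1 := le_mul_ceilDiv hk y
  have h2 := mul_ceilDiv_lt hk y
  exact ceilDiv_eq hk (by linarith) (by linarith)

/-- Monotonicity puts the missing unit between `y - 1` and `y`, and the ceiling jumps only on
arrival at `1` mod `k`. -/
theorem eq_mul_add_one_of_ceilDiv_neighbours {k y : ℤ} (hk : 0 < k)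
    (h : ceilDiv k (y + 1) + ceilDiv k (y - 1) = 2 * ceilDiv k y - 1) :
    y = k * (ceilDiv k y - 1) + 1 := by
  have h1 := mul_ceilDiv_lt hk y
  have h2 := ceilDiv_mono hk (show y ≤ y + 1 by linarith)
  have h3 : ceilDiv k (y - 1) ≤ ceilDiv k y - 1 := by linarith
  have h4 := le_mul_ceilDiv hk (y - 1)
  have h5 := mul_le_mul_of_nonneg_left h3 hk.le
  linarith

/-! ### Classification of the shapes -/

namespace LShape

variable {a d k c s s' p p' t t' : ℤ} {S : AddSubmonoid ℤ}

/-- Pair `(1, 0)` with `(Y - 1, Z)`. If both are the exceptional point, then `Y = 2` and `Z = 0`;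
otherwise the ceilings force `Y` to be `1` mod `k`. Then the reflection respects weights on the
whole rectangle, so the exceptional point, whose doubled weight is off by `a`, cannot be in it. -/
theorem corner_of_pairing (h : LShape a d k c s s' p p' t t') {Y Z y₀ z₀ : ℤ}
    (hY : 0 ≤ Y) (hZ : 0 ≤ Z)
    (hrect : ∀ y z, 0 ≤ y → 0 ≤ z → y ≤ Y → z ≤ Z → InShape s s' p p' y z)
    (he2 : 2 * weight a d k c y₀ z₀ = weight a d k c Y Z + a)
    (he : InShape s s' p p' y₀ z₀)
    (hpair : ∀ y z y' z', InShape s s' p p' y z → InShape s s' p p' y' z' →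
        a ∣ d * (y + y' - Y) + c * (z + z' - Z) →
        weight a d k c y z + weight a d k c y' z' = weight a d k c Y Z ∨
          (y = y₀ ∧ z = z₀ ∧ y' = y₀ ∧ z' = z₀)) :
    (Y = 2 ∧ Z = 0 ∧ y₀ = 1 ∧ z₀ = 0) ∨
      ((Y = 0 ∨ ∃ Q, Y = k * Q + 1) ∧ ¬ (y₀ ≤ Y ∧ z₀ ≤ Z)) := by
  have hk := h.k_pos
  have ha := h.a_pos
  by_cases hY' : Y = 0 ∨ ∃ Q, Y = k * Q + 1
  · right
    refine ⟨hY', fun ⟨h1, h2⟩ => ?_⟩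
    have hadd := ceilDiv_add_ceilDiv_sub hk hY' he.1 h1
    have hu' := hrect (Y - y₀) (Z - z₀) (by linarith) (by linarith) (by linarith [he.1])
      (by linarith [he.2.1])
    have hsum : weight a d k c y₀ z₀ + weight a d k c (Y - y₀) (Z - z₀) = weight a d k c Y Z := by
      unfold weight
      linear_combination a * hadd
    obtain ⟨h3, h4⟩ := h.weight_inShape_unique hu' he ⟨-1, by linarith⟩
    rw [h3, h4] at hsum
    linarith
  · left
    push Not at hY'
    have hY1 : 1 ≤ Y := by have := hY'.1; omega
    rcases hpair 1 0 (Y - 1) Z (hrect _ _ (by linarith) le_rfl hY1 hZ)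
      (hrect _ _ (by linarith) hZ (by linarith) le_rfl) ⟨0, by ring⟩ with hsum | hh
    · exfalso
      obtain ⟨Q, hQ⟩ := eq_mul_add_one_of_ceilDiv hk (Y := Y) (by
        apply mul_left_cancel₀ ha.ne'
        unfold weight at hsum
        linear_combination hsum)
      exact hY'.2 Q hQ
    · omega

/-- The possible shapes of the Apéry set of a pseudo-symmetric semigroup. -/
theorem shape_of_isPseudoSymmetric (h : LShape a d k c s s' p p' t t')
    (hS : IsAlmostArithmetic a d k c S) (hps : IsPseudoSymmetric S) :
    (s = 3 ∧ p = 1 ∧ p' = 0) ∨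
    (s = 3 ∧ s' = 2 ∧ p = p' + 1 ∧ t' = -1) ∨
    ((∃ j, s = k * j + 3) ∧ s' = 1 ∧ p = p' + 1 ∧ k * t + s = 3) ∨
    ((∃ j, s = k * j + 1) ∧ s' = 2 * k - 1 ∧ p = p' + 1 ∧ k * t + s = 1) ∨
    ((∃ j, s = k * j + 2) ∧ p' = 1 ∧ s = s' + 1 ∧ k * t' + s' = 1 - 2 * k) ∨
    ((∃ j, s = k * j + 2) ∧ p' = 1 ∧ s = s' + 3 ∧ k * t' + s' = -1) := by
  obtain ⟨Y, Z, y₀, z₀, hYZ, he, he2, hWa, hpair⟩ :=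
    h.exists_corner hS hps
  have ha := h.a_pos
  have hd := h.d_pos
  have hc := h.c_pos
  have hk := h.k_pos
  have hk2 := h.k_two
  have hs := h.s'_lt
  have hs' := h.s'_nonneg
  have hp := h.p'_lt
  have hp' := h.p'_nonneg
  have row := h.row
  have row' := h.row'
  have det := h.det
  have hrect : ∀ y z, 0 ≤ y → 0 ≤ z → y ≤ Y → z ≤ Z → InShape s s' p p' y z := by
    intro y z hy hz hyY hzZ
    refine ⟨hy, hz, ?_⟩
    rcases hYZ with ⟨rfl, rfl⟩ | ⟨rfl, rfl⟩
    · left; omega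
    · right; omega
  have hr := h.corner_of_pairing (by omega) (by omega) hrect he2 he hpair
  rcases hYZ with ⟨rfl, rfl⟩ | ⟨rfl, rfl⟩
  · -- the maximum is attained at the upper left corner
    have hB : ∀ y z, s - s' ≤ y → y < s → 0 ≤ z → z < p - p' →
        (ceilDiv k y + ceilDiv k (2 * s - s' - 1 - y) + t = ceilDiv k (s - s' - 1) ∨
          (y = y₀ ∧ z = z₀ ∧ 2 * s - s' - 1 - y = y₀ ∧ p - p' - 1 - z = z₀)) := by
      intro y z h1 h2 h3 h4
      -- Reflection of the remaining rectangle: the two points add up to the corner plus the lattice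
      -- vector `(s, -p')`, which contributes `t`.
      rcases hpair y z (2 * s - s' - 1 - y) (p - p' - 1 - z)
        ⟨by linarith, h3, Or.inr ⟨h2, h4⟩⟩
        ⟨by linarith, by linarith, Or.inr ⟨by linarith, by linarith⟩⟩
        ⟨t, by linear_combination row⟩ with hsum | hh
      · left
        apply mul_left_cancel₀ ha.ne'
        unfold weight at hsum
        linear_combination hsum - row
      · exact Or.inr hh
    rcases hr with ⟨hY, hZ, rfl, rfl⟩ | ⟨hY, hout⟩
    · left
      have hp1 : p = 1 := by linarith
      have hp0 : p' = 0 := by linarith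
      refine ⟨?_, hp1, hp0⟩
      subst hp1 hp0
      by_contra hs3
      have ht : t = d := by
        apply mul_left_cancel₀ ha.ne'
        linear_combination d * det - row
      rcases hB (s - s') 0 le_rfl (by omega) le_rfl (by norm_num) with hh | hh
      · rw [hY, ceilDiv_two hk2] at hh
        have h1 := ceilDiv_mono hk (show 1 ≤ s - s' by linarith)
        have h2 := ceilDiv_mono hk (show 1 ≤ 2 * s - s' - 1 - (s - s') by linarith)
        rw [ceilDiv_one hk] at h1 h2
        linarith
      · linarith [hh.1]
    · -- the exceptional point is the centre of the remaining rectangle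
      have hy0 : s - s' ≤ y₀ := by
        by_contra! hlt
        refine hout ⟨by linarith, ?_⟩
        rcases he.2.2 with h1 | h1 <;> linarith
      have hy0' : y₀ < s := by rcases he.2.2 with h1 | h1 <;> linarith
      have hz0 : 0 ≤ z₀ := he.2.1
      have hz0' : z₀ < p - p' := by rcases he.2.2 with h1 | h1 <;> linarith
      have hu' : InShape s s' p p' (2 * s - s' - 1 - y₀) (p - p' - 1 - z₀) :=
        ⟨by linarith, by linarith, Or.inr ⟨by linarith, by linarith⟩⟩
      obtain ⟨hyc, hzc⟩ := h.weight_inShape_unique hu' he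
        ⟨ceilDiv k (2 * s - s' - 1 - y₀) + ceilDiv k y₀ + t - ceilDiv k (s - s' - 1) - 1, by
          unfold weight at he2 ⊢
          linear_combination row - he2⟩
      have hN : 2 * ceilDiv k y₀ + t = ceilDiv k (s - s' - 1) + 1 := by
        apply mul_left_cancel₀ ha.ne'
        unfold weight at he2
        linear_combination he2 - row + d * hyc + c * hzc
      -- The ceiling identity does not involve `z`, and `hN` violates it at `y₀`; so the centre is
      -- alone in its column.
      have hpp : p = p' + 1 := by
        by_contra hne
        rcases hB y₀ (z₀ + 1) hy0 hy0' (by linarith) (by omega) with hh | hh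
        · rw [hyc] at hh
          linarith
        · linarith [hh.2.1]
      have hz00 : z₀ = 0 := by linarith
      by_cases hs1 : s' = 1
      · right; right; left
        have hys : y₀ = s - 1 := by linarith
        rw [hys, hs1] at hN
        rw [hs1] at hY
        rcases hY with hY | ⟨Q, hQ⟩
        · exfalso
          have hs2 : s = 2 := by linarith
          rw [hs2] at hN
          norm_num [ceilDiv_one hk, ceilDiv_zero] at hN
          have hR := h.pos
          have ht : t = -1 := by linarith
          rw [ht] at hR
          linarith
        · have hsQ : s = k * Q + 3 := by linarith
          have e1 : ceilDiv k (s - 1) = Q + 1 :=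
            ceilDiv_eq hk (by linarith) (by linarith)
          have e2 : ceilDiv k (s - 1 - 1) = Q + 1 :=
            ceilDiv_eq hk (by linarith) (by linarith)
          rw [e1, e2] at hN
          have ht : t = -Q := by linarith
          exact ⟨⟨Q, hsQ⟩, hs1, hpp, by rw [ht, hsQ]; ring⟩
      · right; right; right; left
        have h1 : ceilDiv k (y₀ + 1) + ceilDiv k (y₀ - 1) = 2 * ceilDiv k y₀ - 1 := by
          rcases hB (y₀ + 1) 0 (by linarith) (by omega) le_rfl (by linarith) with hh | hh
          · rw [show 2 * s - s' - 1 - (y₀ + 1) = y₀ - 1 by linarith] at hh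
            linarith
          · linarith [hh.1]
        have hy1 := eq_mul_add_one_of_ceilDiv_neighbours hk h1
        -- At `y₀ ± k` the ceilings add up to `2⌈y₀/k⌉`, the value allowed only at the centre, so
        -- these points lie outside the rectangle.
        have hsk : s' ≤ 2 * k - 1 := by
          by_contra! hlt
          rcases hB (y₀ + k) 0 (by linarith) (by omega) le_rfl (by linarith) with hh | hh
          · rw [show 2 * s - s' - 1 - (y₀ + k) = y₀ - k by linarith, ceilDiv_add_self hk,
              ceilDiv_sub_self hk] at hh
            linarith
          · linarith [hh.1]
        obtain ⟨m, hm⟩ : ∃ m, m = ceilDiv k y₀ := ⟨_, rfl⟩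
        rw [← hm] at hy1 hN
        -- with `s' = 2 i + 1`, the shape forces `1 ≤ i ≤ k - 1` and `k ∣ i + 1`
        obtain ⟨i, hi⟩ : ∃ i, s' = 2 * i + 1 := ⟨s - 1 - y₀, by linarith⟩
        have hYv : s - s' - 1 = k * (m - 1) - i := by linarith
        have hik : i = k - 1 := by
          rcases hY with hY | ⟨Q, hQ⟩
          · exfalso
            have e : k * (m - 1) = i := by linarith
            have i1 : 0 < m - 1 := by
              by_contra! hle
              nlinarith [mul_nonneg hk.le (sub_nonneg.2 hle), show 1 ≤ i by omega]
            nlinarith [mul_le_mul_of_nonneg_left (Int.add_one_le_iff.2 i1) hk.le]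
          · have e : k * (m - 1 - Q) = i + 1 := by linarith
            have i1 : 0 < m - 1 - Q := by
              by_contra! hle
              nlinarith [mul_nonneg hk.le (sub_nonneg.2 hle), show 1 ≤ i by omega]
            nlinarith [mul_le_mul_of_nonneg_left (Int.add_one_le_iff.2 i1) hk.le]
        have hs'k : s' = 2 * k - 1 := by linarith
        have hsm : s = k * m + 1 := by linarith
        have e2 : ceilDiv k (s - s' - 1) = m - 1 :=
          ceilDiv_eq hk (by linarith) (by linarith)
        rw [e2] at hN
        have ht : t = -m := by linarith
        exact ⟨⟨m, hsm⟩, hs'k, hpp, by rw [ht, hsm]; ring⟩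
  · -- the maximum is attained at the lower right corner
    have hB : ∀ y z, 0 ≤ y → y < s - s' → p - p' ≤ z → z < p →
        (ceilDiv k y + ceilDiv k (s - s' - 1 - y) - t' = ceilDiv k (s - 1) ∨
          (y = y₀ ∧ z = z₀ ∧ s - s' - 1 - y = y₀ ∧ 2 * p - p' - 1 - z = z₀)) := by
      intro y z h1 h2 h3 h4
      -- Here the two points add up to the corner minus `(s', -p)`, which contributes `-t'`.
      rcases hpair y z (s - s' - 1 - y) (2 * p - p' - 1 - z)
        ⟨h1, by linarith, Or.inl ⟨h2, h4⟩⟩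
        ⟨by linarith, by linarith, Or.inl ⟨by linarith, by linarith⟩⟩
        ⟨-t', by linear_combination -row'⟩ with hsum | hh
      · left
        apply mul_left_cancel₀ ha.ne'
        unfold weight at hsum
        linear_combination hsum + row'
      · exact Or.inr hh
    have hR' := h.nonpos
    rcases hr with ⟨hY, hZ, rfl, rfl⟩ | ⟨hY, hout⟩
    · have hs3 : s = 3 := by linarith
      have hpp : p = p' + 1 := by linarith
      by_cases hp0 : p' = 0
      · left
        exact ⟨hs3, by linarith, hp0⟩
      · right; left
        have hB' : ∀ y, 0 ≤ y → y < s - s' →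
            ceilDiv k y + ceilDiv k (s - s' - 1 - y) - t' = 1 := by
          intro y h1 h2
          rcases hB y (p - 1) h1 h2 (by omega) (by linarith) with hh | hh
          · rwa [hY, ceilDiv_two hk2] at hh
          · omega
        subst hs3
        have hs'3 : s' = 0 ∨ s' = 1 ∨ s' = 2 := by omega
        rcases hs'3 with rfl | rfl | rfl
        · exfalso
          have h0 := hB' 0 le_rfl (by norm_num)
          have h1 := hB' 1 (by norm_num) (by norm_num)
          norm_num [ceilDiv_zero, ceilDiv_one hk, ceilDiv_two hk2] at h0 h1
          linarith
        · exfalso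
          have h0 := hB' 0 le_rfl (by norm_num)
          norm_num [ceilDiv_zero, ceilDiv_one hk] at h0
          rw [h0] at hR'
          linarith
        · have h0 := hB' 0 le_rfl (by norm_num)
          norm_num [ceilDiv_zero] at h0
          exact ⟨rfl, rfl, hpp, by linarith⟩
    · have hz0 : p - p' ≤ z₀ := by
        by_contra! hlt
        refine hout ⟨?_, by linarith⟩
        rcases he.2.2 with h1 | h1 <;> linarith
      have hz0' : z₀ < p := by rcases he.2.2 with h1 | h1 <;> linarith
      have hy0 : 0 ≤ y₀ := he.1
      have hy0' : y₀ < s - s' := by rcases he.2.2 with h1 | h1 <;> linarith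
      have hu' : InShape s s' p p' (s - s' - 1 - y₀) (2 * p - p' - 1 - z₀) :=
        ⟨by linarith, by linarith, Or.inl ⟨by linarith, by linarith⟩⟩
      obtain ⟨hyc, hzc⟩ := h.weight_inShape_unique hu' he
        ⟨ceilDiv k (s - s' - 1 - y₀) + ceilDiv k y₀ - t' - ceilDiv k (s - 1) - 1, by
          unfold weight at he2 ⊢
          linear_combination -row' - he2⟩
      have hN : 2 * ceilDiv k y₀ - t' = ceilDiv k (s - 1) + 1 := by
        apply mul_left_cancel₀ ha.ne'
        unfold weight at he2
        linear_combination he2 + row' + d * hyc + c * hzc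
      have hpp : p' = 1 := by
        by_contra hne
        rcases hB y₀ (z₀ + 1) hy0 hy0' (by linarith) (by omega) with hh | hh
        · rw [hyc] at hh
          linarith
        · linarith [hh.2.1]
      -- `s = 1` would force `c = 1` and corner weight `a - 2`, less than `a`.
      have hsne : s - 1 ≠ 0 := by
        intro h0
        have h1 : s' = 0 := by linarith
        have h2 : s = 1 := by linarith
        subst hpp h1 h2
        have h3 : y₀ = 0 := by linarith
        rw [h3] at hN
        norm_num [ceilDiv_zero] at hN
        have h5 : t' = -1 := by linarith
        rw [h5] at row'
        have h6 : p = a := by linarith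
        rw [h6] at row' hWa
        have h7 : c = 1 := mul_right_cancel₀ ha.ne' (by linarith)
        rw [h7] at hWa
        norm_num [weight, ceilDiv_zero] at hWa
        linarith
      obtain ⟨Q, hQ⟩ : ∃ Q, s - 1 = k * Q + 1 := hY.resolve_left hsne
      have hsQ : s = k * Q + 2 := by linarith
      have e1 : ceilDiv k (s - 1) = Q + 1 := ceilDiv_eq hk (by linarith) (by linarith)
      rw [e1] at hN
      by_cases hy00 : y₀ = 0
      · right; right; right; right; left
        rw [hy00, ceilDiv_zero] at hN
        have ht : t' = -Q - 2 := by linarith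
        have hs1 : s = s' + 1 := by linarith
        exact ⟨⟨Q, hsQ⟩, hpp, hs1, by rw [ht]; linarith⟩
      · right; right; right; right; right
        have hB' : ∀ y, 0 ≤ y → y ≤ 2 * y₀ → y ≠ y₀ →
            ceilDiv k y + ceilDiv k (2 * y₀ - y) = 2 * ceilDiv k y₀ - 1 := by
          intro y h1 h2 h3
          rcases hB y z₀ h1 (by linarith) hz0 hz0' with hh | hh
          · rw [show s - s' - 1 - y = 2 * y₀ - y by linarith] at hh
            linarith
          · exact absurd hh.1 h3
        have h1 := hB' (y₀ + 1) (by linarith) (by omega) (by linarith)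
        rw [show 2 * y₀ - (y₀ + 1) = y₀ - 1 by ring] at h1
        have hy1 := eq_mul_add_one_of_ceilDiv_neighbours hk h1
        have hyk : y₀ < k := by
          by_contra! hle
          have h2 := hB' (y₀ + k) (by linarith) (by linarith) (by linarith)
          rw [show 2 * y₀ - (y₀ + k) = y₀ - k by ring, ceilDiv_add_self hk,
            ceilDiv_sub_self hk] at h2
          linarith
        have hm : ceilDiv k y₀ = 1 := ceilDiv_eq hk (by linarith) (by
          have : 1 ≤ y₀ := by omega
          linarith)
        rw [hm] at hy1 hN
        have ht : t' = -Q := by linarith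
        have hs3 : s = s' + 3 := by linarith
        exact ⟨⟨Q, hsQ⟩, hpp, hs3, by rw [ht]; linarith⟩

end LShape

/-! ### Each shape in the list is pseudo-symmetric -/

namespace LShape

variable {a d k c s s' p p' t t' : ℤ} {S : AddSubmonoid ℤ}

theorem le_weight (h : LShape a d k c s s' p p' t t') {y z : ℤ} (hy : 1 ≤ y) (hz : 0 ≤ z) :
    a ≤ weight a d k c y z := by
  have h1 := weight_mono h.a_pos h.d_pos h.k_pos h.c_pos hy hz
  have h2 := h.d_pos
  rw [show weight a d k c 1 0 = a + d by simp [weight, ceilDiv_one h.k_pos]] at h1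
  linarith

/-- The remaining rectangle is a single row with centre `(y₀, 0)`, so the pairing reduces to ceiling
identities along that row. -/
theorem isPseudoSymmetric_of_upper_corner (h : LShape a d k c s s' p p' t t')
    (hS : IsAlmostArithmetic a d k c S) {Q y₀ : ℤ} (hQ : s - s' - 1 = k * Q + 1) (hpp : p = p' + 1)
    (hs' : 0 < s') (hy₀ : 2 * y₀ = 2 * s - s' - 1) (hN : 2 * ceilDiv k y₀ + t = Q + 2)
    (hB : ∀ y, s - s' ≤ y → y < s → y ≠ y₀ →
      ceilDiv k y + ceilDiv k (2 * y₀ - y) + t = Q + 1) :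
    IsPseudoSymmetric S := by
  have hk := h.k_pos
  have hs := h.s'_lt
  have hp := h.p'_lt
  have hp' := h.p'_nonneg
  have row := h.row
  have hNY : ceilDiv k (s - s' - 1) = Q + 1 := by
    rw [hQ]
    exact ceilDiv_eq hk (by linarith) (by linarith)
  have hY1 : 1 ≤ s - s' - 1 := by
    by_contra! hlt
    have h0 : k * Q = -1 := by linarith
    have : k ∣ 1 := ⟨-Q, by linarith⟩
    have := Int.le_of_dvd one_pos this
    linarith [h.k_two]
  refine h.isPseudoSymmetric_of_pairing hS (y₀ := y₀) (z₀ := 0)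
    (W := weight a d k c (s - s' - 1) (p - 1))
    ⟨by linarith, le_rfl, Or.inr ⟨by linarith, by linarith⟩⟩ (h.le_weight hY1 (by linarith)) ?_ ?_
  · unfold weight
    rw [hNY]
    linear_combination a * hN + row + d * hy₀ - c * hpp
  · rintro y z ⟨hy, hz, hL⟩
    by_cases hyY : y < s - s'
    · right
      refine ⟨s - s' - 1 - y, p - 1 - z, ⟨by linarith, ?_, Or.inl ⟨by linarith, by linarith⟩⟩, ?_⟩
      · rcases hL with hL | hL <;> linarith
      · have := ceilDiv_add_ceilDiv_sub hk (Or.inr ⟨Q, hQ⟩) hy (show y ≤ s - s' - 1 by linarith)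
        unfold weight
        linear_combination a * this
    · have hL' := hL.resolve_left (fun hL => hyY hL.1)
      have hz0 : z = 0 := by omega
      subst hz0
      by_cases hyy : y = y₀
      · exact Or.inl ⟨hyy, rfl⟩
      · right
        refine ⟨2 * y₀ - y, 0, ⟨by linarith, le_rfl, Or.inr ⟨by linarith, by linarith⟩⟩, ?_⟩
        have := hB y (by linarith) hL'.1 hyy
        unfold weight
        rw [hNY]
        linear_combination a * this + row + d * hy₀ - c * hpp

theorem isPseudoSymmetric_of_lower_corner (h : LShape a d k c s s' p p' t t')
    (hS : IsAlmostArithmetic a d k c S) {Q y₀ : ℤ} (hQ : s = k * Q + 2) (hpp : p' = 1)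
    (hy₀ : 2 * y₀ = s - s' - 1) (hN : 2 * ceilDiv k y₀ - t' = Q + 2)
    (hB : ∀ y, 0 ≤ y → y ≤ 2 * y₀ → y ≠ y₀ →
      ceilDiv k y + ceilDiv k (2 * y₀ - y) - t' = Q + 1) :
    IsPseudoSymmetric S := by
  have hk := h.k_pos
  have hs := h.s'_lt
  have hs' := h.s'_nonneg
  have hp := h.p'_lt
  have row' := h.row'
  have hQ' : s - 1 = k * Q + 1 := by linarith
  have hNY : ceilDiv k (s - 1) = Q + 1 := by
    rw [hQ']
    exact ceilDiv_eq hk (by linarith) (by linarith)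
  have hY1 : 1 ≤ s - 1 := by
    by_contra! hlt
    have h0 : k * Q = -1 := by linarith
    have : k ∣ 1 := ⟨-Q, by linarith⟩
    have := Int.le_of_dvd one_pos this
    linarith [h.k_two]
  refine h.isPseudoSymmetric_of_pairing hS (y₀ := y₀) (z₀ := p - 1)
    (W := weight a d k c (s - 1) (p - p' - 1))
    ⟨by linarith, by linarith, Or.inl ⟨by linarith, by linarith⟩⟩
    (h.le_weight hY1 (by linarith)) ?_ ?_
  · unfold weight
    rw [hNY]
    linear_combination a * hN - row' + d * hy₀ + c * hpp
  · rintro y z ⟨hy, hz, hL⟩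
    by_cases hzZ : z < p - p'
    · right
      refine ⟨s - 1 - y, p - p' - 1 - z, ⟨?_, by linarith, Or.inr ⟨by linarith, by linarith⟩⟩, ?_⟩
      · rcases hL with hL | hL <;> linarith
      · have := ceilDiv_add_ceilDiv_sub hk (Or.inr ⟨Q, hQ'⟩) hy (show y ≤ s - 1 by
          rcases hL with hL | hL <;> linarith)
        unfold weight
        linear_combination a * this
    · have hL' := hL.resolve_right (fun hL => hzZ hL.2)
      have hz0 : z = p - 1 := by omega
      subst hz0
      by_cases hyy : y = y₀
      · exact Or.inl ⟨hyy, rfl⟩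
      · right
        refine ⟨2 * y₀ - y, p - 1,
          ⟨by linarith, by linarith, Or.inl ⟨by linarith, by linarith⟩⟩, ?_⟩
        have := hB y hy (by linarith) hyy
        unfold weight
        rw [hNY]
        linear_combination a * this - row' + d * hy₀ + c * hpp

/-- The bottom row is reflected about `(1, 0)`. When `p' > 0`, the other points form the column `y =
0`, where `z` is paired with `p - z` because `c p = a + 2 d`. -/
theorem isPseudoSymmetric_of_eq_three (h : LShape a d k c s s' p p' t t')
    (hS : IsAlmostArithmetic a d k c S) (hs : s = 3) (hpp : p = p' + 1)
    (hB : p' = 0 ∨ s' = 2 ∧ t' = -1) : IsPseudoSymmetric S := by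
  have hk := h.k_pos
  have hk2 := h.k_two
  have hs' := h.s'_nonneg
  have row' := h.row'
  have h1 := ceilDiv_one hk
  have h2 := ceilDiv_two hk2
  have h0 := ceilDiv_zero k
  have hs's := h.s'_lt
  subst hs
  have hrow : ∀ y, 0 ≤ y → y < 3 → InShape 3 s' p p' y 0 := fun y hy hy' =>
    ⟨hy, le_rfl, Or.inr ⟨hy', by linarith⟩⟩
  refine h.isPseudoSymmetric_of_pairing hS (y₀ := 1) (z₀ := 0) (W := weight a d k c 2 0)
    (hrow 1 (by norm_num) (by norm_num)) (h.le_weight (by norm_num) le_rfl) ?_ ?_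
  · unfold weight
    rw [h1, h2]
    ring
  · rintro y z ⟨hy, hz, hL⟩
    by_cases hz0 : z = 0
    · subst hz0
      have hy3 : y = 0 ∨ y = 1 ∨ y = 2 := by
        rcases hL with hL | hL <;> omega
      rcases hy3 with rfl | rfl | rfl
      · exact Or.inr ⟨2, 0, hrow 2 (by norm_num) (by norm_num), by simp [weight, h0]⟩
      · exact Or.inl ⟨rfl, rfl⟩
      · exact Or.inr ⟨0, 0, hrow 0 (by norm_num) (by norm_num), by simp [weight, h0]⟩
    · right
      rcases hB with hB | ⟨rfl, rfl⟩
      · rcases hL with hL | hL <;> omega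
      · have hy0 : y = 0 ∧ z < p := by rcases hL with hL | hL <;> omega
        obtain ⟨rfl, hzp⟩ := hy0
        refine ⟨0, p - z, ⟨le_rfl, by linarith, Or.inl ⟨by norm_num, by omega⟩⟩, ?_⟩
        unfold weight
        rw [h0, h2]
        linear_combination -row'

theorem isPseudoSymmetric_of_s'_eq_one (h : LShape a d k c s s' p p' t t')
    (hS : IsAlmostArithmetic a d k c S) {j : ℤ} (hs : s = k * j + 3) (hs' : s' = 1)
    (hpp : p = p' + 1) (hR : k * t + s = 3) : IsPseudoSymmetric S := by
  have hk := h.k_pos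
  have hk2 := h.k_two
  have ht : t = -j := mul_left_cancel₀ hk.ne' (by linarith)
  have e1 : ceilDiv k (s - 1) = j + 1 := ceilDiv_eq hk (by linarith) (by linarith)
  refine h.isPseudoSymmetric_of_upper_corner hS (Q := j) (y₀ := s - 1) (by linarith) hpp
    (by linarith) (by linarith) (by linarith) ?_
  intro y h1 h2 h3
  exact absurd (by omega) h3

theorem isPseudoSymmetric_of_s'_eq_two_mul_sub_one (h : LShape a d k c s s' p p' t t')
    (hS : IsAlmostArithmetic a d k c S) {j : ℤ} (hs : s = k * j + 1) (hs' : s' = 2 * k - 1)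
    (hpp : p = p' + 1) (hR : k * t + s = 1) : IsPseudoSymmetric S := by
  have hk := h.k_pos
  have hk2 := h.k_two
  have ht : t = -j := mul_left_cancel₀ hk.ne' (by linarith)
  have e1 : ceilDiv k (s - k) = j := ceilDiv_eq hk (by linarith) (by linarith)
  refine h.isPseudoSymmetric_of_upper_corner hS (Q := j - 2) (y₀ := s - k) (by linarith) hpp
    (by linarith) (by linarith) (by linarith) ?_
  intro y h1 h2 h3
  rcases lt_or_gt_of_ne h3 with h3 | h3
  · have h3' := Int.add_one_le_iff.2 h3
    have e2 : ceilDiv k y = j - 1 := ceilDiv_eq hk (by linarith) (by linarith)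
    have e3 : ceilDiv k (2 * (s - k) - y) = j := ceilDiv_eq hk (by linarith) (by linarith)
    linarith
  · have h3' := Int.add_one_le_iff.2 h3
    have e2 : ceilDiv k y = j := ceilDiv_eq hk (by linarith) (by linarith)
    have e3 : ceilDiv k (2 * (s - k) - y) = j - 1 := ceilDiv_eq hk (by linarith) (by linarith)
    linarith

theorem isPseudoSymmetric_of_eq_add_one (h : LShape a d k c s s' p p' t t')
    (hS : IsAlmostArithmetic a d k c S) {j : ℤ} (hs : s = k * j + 2) (hs' : s = s' + 1)
    (hpp : p' = 1) (hR : k * t' + s' = 1 - 2 * k) : IsPseudoSymmetric S := by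
  have hk := h.k_pos
  have ht : t' = -j - 2 := mul_left_cancel₀ hk.ne' (by linarith)
  refine h.isPseudoSymmetric_of_lower_corner hS (Q := j) (y₀ := 0) hs hpp (by linarith)
    (by rw [ceilDiv_zero]; linarith) ?_
  intro y h1 h2 h3
  exact absurd (by omega) h3

theorem isPseudoSymmetric_of_eq_add_three (h : LShape a d k c s s' p p' t t')
    (hS : IsAlmostArithmetic a d k c S) {j : ℤ} (hs : s = k * j + 2) (hs' : s = s' + 3)
    (hpp : p' = 1) (hR : k * t' + s' = -1) : IsPseudoSymmetric S := by
  have hk := h.k_pos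
  have hk2 := h.k_two
  have ht : t' = -j := mul_left_cancel₀ hk.ne' (by linarith)
  refine h.isPseudoSymmetric_of_lower_corner hS (Q := j) (y₀ := 1) hs hpp (by linarith)
    (by rw [ceilDiv_one hk]; linarith) ?_
  intro y h1 h2 h3
  have : y = 0 ∨ y = 2 := by omega
  rcases this with rfl | rfl <;> norm_num [ceilDiv_zero, ceilDiv_two hk2] <;> linarith

end LShape

/-! ### Coprimality of `a` and `d` -/

/-- The differences of a pseudo-symmetric semigroup generated by an almost arithmetic sequence
are coprime to its first term. -/
theorem IsPseudoSymmetric.eq_one_of_dvd {a d k c e : ℤ} {S : AddSubmonoid ℤ}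
    (hS : IsAlmostArithmetic a d k c S) (hps : IsPseudoSymmetric S) (hc : 0 < c) (he : 0 < e)
    (hea : e ∣ a) (hed : e ∣ d) : e = 1 := by
  obtain ⟨g, ⟨hg, hmax⟩, ⟨r, hr⟩, hunion⟩ := hps
  have hgt : ∀ x, g < x → x ∈ S := by
    intro x hx
    by_contra hn
    exact absurd (hmax hn) (not_le.2 hx)
  have hcz : ∀ z, 0 ≤ z → c * z ∈ S := fun z hz =>
    (hS _).2 ⟨0, 0, z, le_rfl, hz, by simp, by ring⟩
  have hdvd : ∀ x ∈ S, ∃ z, 0 ≤ z ∧ e ∣ x - c * z ∧ ∀ w, 0 ≤ w → w ≤ z → x - c * w ∈ S := by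
    intro x hx
    obtain ⟨n, y, z, hy, hz, hn, rfl⟩ := (hS x).1 hx
    refine ⟨z, hz, ?_, fun w hw hwz => ?_⟩
    · obtain ⟨a', rfl⟩ := hea
      obtain ⟨d', rfl⟩ := hed
      exact ⟨a' * n + d' * y, by ring⟩
    · exact (hS _).2 ⟨n, y, z - w, hy, by linarith, hn, by ring⟩
  have hcop : IsCoprime e c := by
    rw [Int.isCoprime_iff_gcd_eq_one]
    have key : ∀ x ∈ S, (Int.gcd e c : ℤ) ∣ x := by
      intro x hx
      obtain ⟨z, -, hz, -⟩ := hdvd x hx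
      have h1 : (Int.gcd e c : ℤ) ∣ x - c * z := (Int.gcd_dvd_left e c).trans hz
      have h2 : (Int.gcd e c : ℤ) ∣ c * z := (Int.gcd_dvd_right e c).mul_right z
      simpa using dvd_add h1 h2
    have h1 := key _ (hgt (g + 1) (by linarith))
    have h2 := key _ (hgt (g + 2) (by linarith))
    have h3 : (Int.gcd e c : ℤ) ∣ 1 := by
      have := dvd_sub h2 h1
      rwa [show g + 2 - (g + 1) = 1 by ring] at this
    exact_mod_cast Int.eq_one_of_dvd_one (by positivity) h3
  -- Mod `e`, an element of `S` is `c z'`, with `z'` its number of copies of `c`. As `c` is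
  -- invertible, `z'` is at least the least residue `z`, so `z` copies can be removed.
  have hsub : ∀ x ∈ S, ∀ z, 0 ≤ z → z < e → e ∣ x - c * z → x - c * z ∈ S := by
    intro x hx z hz hze hxz
    obtain ⟨z', hz', hxz', hall⟩ := hdvd x hx
    refine hall z hz ?_
    obtain ⟨m, hm⟩ : e ∣ z' - z := hcop.dvd_of_dvd_mul_left (by
      have := dvd_sub hxz hxz'
      rwa [show x - c * z - (x - c * z') = c * (z' - z) by ring] at this)
    by_contra! hlt
    have : m ≤ -1 := by
      by_contra! h0
      have := mul_nonneg he.le (show 0 ≤ m by linarith)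
      linarith
    nlinarith
  obtain ⟨z, hz, hze, m, hm⟩ : ∃ z, 0 ≤ z ∧ z < e ∧ e ∣ r - c * z := by
    obtain ⟨u, v, huv⟩ := hcop
    refine ⟨(v * r) % e, Int.emod_nonneg _ he.ne', Int.emod_lt_of_pos _ he, ?_⟩
    have := Int.mul_ediv_add_emod (v * r) e
    exact ⟨u * r + c * (v * r / e), by linear_combination -r * huv - c * this⟩
  -- `g + c` is `c (2 z + 1)` mod `e`. If `2 z + 1 ≠ e`, its least residue is positive; removing
  -- that many copies of `c` and restoring one fewer would put `g` in `S`.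
  have hgc : g + c ∈ S := hgt _ (by linarith)
  have h1 : ¬ 2 * z < e - 1 := by
    intro hlt
    have h2 := hsub _ hgc (2 * z + 1) (by linarith) (by linarith) ⟨2 * m, by linarith⟩
    have h3 := S.add_mem h2 (hcz (2 * z) (by linarith))
    exact hg (by convert h3 using 1; ring)
  have h2 : ¬ e - 1 < 2 * z := by
    intro hlt
    have h2 := hsub _ hgc (2 * z - e + 1) (by linarith) (by linarith)
      ⟨2 * m + c, by linear_combination hr + 2 * hm⟩
    have h3 := S.add_mem h2 (hcz (2 * z - e) (by linarith))
    exact hg (by convert h3 using 1; ring)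
  -- Now `2 z + 1 = e`, and `e ≠ 1` gives `z + 1 < e`. One of `r - c` and its mirror image `r + c`
  -- is in `S`, and either one puts `r` in `S`.
  by_contra hne
  have hr2 : g / 2 = r := by omega
  have hrS : r ∉ S := by
    intro hrS
    have := (Set.ext_iff.1 hunion r).1 (Or.inl hrS)
    simp [hr2] at this
  rcases (Set.ext_iff.1 hunion (r - c)).2 (by simp [hr2]; linarith) with hx | ⟨σ, hσ, hx⟩
  · have := S.add_mem hx (hcz 1 zero_le_one)
    exact hrS (by convert this using 1; ring)
  · have h3 := hsub σ hσ (z + 1) (by linarith) (by omega) ⟨m, by linarith⟩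
    have h4 := S.add_mem h3 (hcz z hz)
    exact hrS (by convert h4 using 1; linarith)

/-! ### L-shapes from the Euclidean algorithm -/

theorem sSeq_mul_pSeq (a d c n : ℕ) :
    sSeq a d c n * pSeq a d c (n + 1) - sSeq a d c (n + 1) * pSeq a d c n = a := by
  induction n with
  | zero => simp [sSeq, pSeq]
  | succ n ih =>
    rw [show pSeq a d c (n + 1 + 1) = qSeq a d c n * pSeq a d c (n + 1) - pSeq a d c n by
      rw [pSeq]]
    linear_combination ih - pSeq a d c (n + 1) * sSeq_eq a d c n

theorem dvd_sSeq_pSeq (a d c : ℕ) (ha : 0 < a) (h : Nat.Coprime a d) (n : ℕ) :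
    (a : ℤ) ∣ d * sSeq a d c n - c * pSeq a d c n := by
  have key : (a : ℤ) ∣ d * sSeq a d c n - c * pSeq a d c n ∧
      (a : ℤ) ∣ d * sSeq a d c (n + 1) - c * pSeq a d c (n + 1) := by
    induction n with
    | zero =>
      refine ⟨⟨d, by simp [sSeq, pSeq, mul_comm]⟩, ?_⟩
      have h1 := (Nat.modEq_iff_dvd.1 (sZero_modEq a d c ha h).symm)
      simpa [sSeq, pSeq] using h1
    | succ n ih =>
      refine ⟨ih.2, ?_⟩
      obtain ⟨⟨m, hm⟩, m', hm'⟩ := ih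
      rw [show pSeq a d c (n + 1 + 1) = qSeq a d c n * pSeq a d c (n + 1) - pSeq a d c n by
        rw [pSeq]]
      exact ⟨qSeq a d c n * m' - m, by
        linear_combination qSeq a d c n * hm' - hm + d * sSeq_eq a d c n⟩
  exact key.1

/-- The number of steps of the algorithm. -/
noncomputable def stepCount (a d c : ℕ) : ℕ := sInf {n : ℕ | sSeq a d c (n + 1) = 0}

theorem sSeq_bounds (a d c : ℕ) (ha : 0 < a) {n : ℕ} (hn : n ≤ stepCount a d c) :
    0 ≤ sSeq a d c (n + 1) ∧ sSeq a d c (n + 1) < sSeq a d c n := by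
  induction n with
  | zero =>
    have := sZero_lt a d c ha
    simp only [sSeq]
    omega
  | succ n ih =>
    have h0 : sSeq a d c (n + 1) ≠ 0 := Nat.notMem_of_lt_sInf (Nat.lt_of_succ_le hn)
    have h1 : 0 < sSeq a d c (n + 1) := lt_of_le_of_ne (ih (by omega)).1 h0.symm
    rw [show sSeq a d c (n + 1 + 1) = (-sSeq a d c n) % sSeq a d c (n + 1) by rw [sSeq]]
    exact ⟨Int.emod_nonneg _ h0, Int.emod_lt_of_pos _ h1⟩

/-- Strictly decreasing remainders force the quotients to be at least `2`, which makes `P` increase.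
-/
theorem pSeq_bounds (a d c : ℕ) (ha : 0 < a) {n : ℕ} (hn : n ≤ stepCount a d c) :
    0 ≤ pSeq a d c n ∧ pSeq a d c n < pSeq a d c (n + 1) := by
  induction n with
  | zero => simp [pSeq]
  | succ n ih =>
    obtain ⟨h1, h2⟩ := ih (by omega)
    obtain ⟨h3, h4⟩ := sSeq_bounds a d c ha (n := n) (by omega)
    obtain ⟨h5, h6⟩ := sSeq_bounds a d c ha hn
    have hq : 2 ≤ qSeq a d c n := by
      by_contra! hlt
      have := sSeq_eq a d c n
      nlinarith
    rw [show pSeq a d c (n + 1 + 1) = qSeq a d c n * pSeq a d c (n + 1) - pSeq a d c n by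
      rw [pSeq]]
    exact ⟨by linarith, by nlinarith⟩

theorem sSeq_stepCount (a d c : ℕ) (ha : 0 < a) : sSeq a d c (stepCount a d c + 1) = 0 :=
  Nat.sInf_mem (exists_sSeq_eq_zero a d c ha)

theorem R_eq {a d k c : ℕ} (ha : 0 < a) {i t : ℤ} (ht : d * s a d c i - c * P a d c i = a * t) :
    R a d k c i = ((k * t + s a d c i : ℤ) : ℚ) := by
  have ha' : (a : ℚ) ≠ 0 := by exact_mod_cast ha.ne'
  have ht' : (d : ℚ) * s a d c i - c * P a d c i = a * t := by exact_mod_cast ht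
  unfold R
  rw [div_eq_iff ha']
  push_cast
  linear_combination k * ht'

theorem lshape_of_index {a d k c : ℕ} (ha : 0 < a) (hd : 0 < d) (hc : 0 < c) (hk : 2 ≤ k)
    (h : Nat.Coprime a d) {v : ℤ} (hv : -1 ≤ v) (hv' : v ≤ lastIndex a d c) :
    ∃ t t' : ℤ, R a d k c v = ((k * t + s a d c v : ℤ) : ℚ) ∧
      R a d k c (v + 1) = ((k * t' + s a d c (v + 1) : ℤ) : ℚ) ∧
      d * s a d c v - c * P a d c v = a * t ∧
      d * s a d c (v + 1) - c * P a d c (v + 1) = a * t' ∧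
      0 ≤ s a d c (v + 1) ∧ s a d c (v + 1) < s a d c v ∧
      0 ≤ P a d c v ∧ P a d c v < P a d c (v + 1) ∧
      s a d c v * P a d c (v + 1) - s a d c (v + 1) * P a d c v = a ∧
      (0 < k * t + s a d c v → k * t' + s a d c (v + 1) ≤ 0 →
        LShape a d k c (s a d c v) (s a d c (v + 1)) (P a d c (v + 1)) (P a d c v) t t') := by
  obtain ⟨n, rfl⟩ : ∃ n : ℕ, v = n - 1 := ⟨(v + 1).toNat, by omega⟩
  have hn : n ≤ stepCount a d c := by
    unfold lastIndex at hv'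
    unfold stepCount
    omega
  have hs0 : s a d c (n - 1) = sSeq a d c n := by simp [s]
  have hs1 : s a d c (n - 1 + 1) = sSeq a d c (n + 1) := by
    unfold s
    congr 1
    omega
  have hp0 : P a d c (n - 1) = pSeq a d c n := by simp [P]
  have hp1 : P a d c (n - 1 + 1) = pSeq a d c (n + 1) := by
    unfold P
    congr 1
    omega
  obtain ⟨t, ht⟩ := dvd_sSeq_pSeq a d c ha h n
  obtain ⟨t', ht'⟩ := dvd_sSeq_pSeq a d c ha h (n + 1)
  rw [← hs0, ← hp0] at ht
  rw [← hs1, ← hp1] at ht'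
  have hsb := sSeq_bounds a d c ha hn
  have hpb := pSeq_bounds a d c ha hn
  have det := sSeq_mul_pSeq a d c n
  rw [← hs0, ← hs1] at hsb
  rw [← hp0, ← hp1] at hpb
  rw [← hs0, ← hs1, ← hp0, ← hp1] at det
  refine ⟨t, t', R_eq ha ht, R_eq ha ht', ht, ht', hsb.1, hsb.2, hpb.1, hpb.2, det, fun h1 h2 => ?_⟩
  exact {
    a_pos := by exact_mod_cast ha
    d_pos := by exact_mod_cast hd
    k_two := by exact_mod_cast hk
    c_pos := by exact_mod_cast hc
    coprime := Nat.isCoprime_iff_coprime.2 h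
    s'_nonneg := hsb.1
    s'_lt := hsb.2
    p'_nonneg := hpb.1
    p'_lt := hpb.2
    det := det
    row := ht
    row' := ht'
    pos := h1
    nonpos := h2 }

theorem natCast_le_pSeq (a d c : ℕ) (ha : 0 < a) {n : ℕ} (hn : n ≤ stepCount a d c + 1) :
    (n : ℤ) ≤ pSeq a d c n := by
  induction n with
  | zero => simp [pSeq]
  | succ n ih =>
    have h1 := ih (by omega)
    have h2 := pSeq_bounds a d c ha (n := n) (by omega)
    push_cast
    omega

theorem eq_zero_of_P_eq_one {a d c : ℕ} (ha : 0 < a) {v : ℤ} (hv : -1 ≤ v)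
    (hv' : v ≤ lastIndex a d c) (hP : P a d c v = 1) : v = 0 := by
  have h1 := natCast_le_pSeq a d c ha (n := (v + 1).toNat) (by
    unfold lastIndex at hv'
    unfold stepCount
    omega)
  change _ ≤ P a d c v at h1
  have h2 : v ≠ -1 := by
    rintro rfl
    simp [P, pSeq] at hP
  omega

/-- `R_{-1} = a + k d` is positive and `R_{m+1} ≤ 0` because `s_{m+1} = 0`; the first nonpositive
term is `R_{v+1}`. -/
theorem exists_isRodsethIndex {a d k c : ℕ} (ha : 0 < a) :
    ∃ v, IsRodsethIndex a d k c v := by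
  classical
  have hR : R a d k c (stepCount a d c : ℕ) ≤ 0 := by
    have h1 : s a d c (stepCount a d c) = 0 := by
      rw [← sSeq_stepCount a d c ha]
      unfold s
      congr 1
    have h2 := pSeq_bounds a d c ha (n := stepCount a d c) le_rfl
    have h3 : (0 : ℚ) ≤ P a d c (stepCount a d c) := by exact_mod_cast h2.1.trans h2.2.le
    have h4 : (0 : ℚ) ≤ k * c * P a d c (stepCount a d c) := by positivity
    unfold R
    rw [h1]
    apply div_nonpos_of_nonpos_of_nonneg _ (by positivity)
    push_cast
    linarith
  have hex : ∃ n : ℕ, R a d k c n ≤ 0 := ⟨_, hR⟩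
  have hle : Nat.find hex ≤ stepCount a d c := Nat.find_min' hex hR
  refine ⟨(Nat.find hex : ℤ) - 1, by omega, ?_, ?_, ?_⟩
  · unfold stepCount at hle
    unfold lastIndex
    omega
  · simpa using Nat.find_spec hex
  · rcases Nat.eq_zero_or_pos (Nat.find hex) with h0 | h0
    · rw [h0]
      have ha' : (0 : ℚ) < a := by exact_mod_cast ha
      simp only [R, s, P, sSeq, pSeq, Nat.cast_zero, zero_sub, neg_add_cancel, Int.toNat_zero]
      push_cast
      rw [mul_zero, sub_zero]
      positivity
    · have := Nat.find_min hex (Nat.sub_lt h0 one_pos)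
      rwa [not_le, Nat.cast_pred h0] at this

/-! ### Cases (a) and (b) -/

theorem aaSemigroup_three_eq_closure {d k c : ℕ} (hc : 0 < c) (hk : 2 ≤ k) {s' t' : ℤ}
    (hs' : 0 ≤ s') (hrow : d * s' - c = 3 * t') (hR : k * t' + s' ≤ 0) :
    aaSemigroup 3 d k c =
      AddSubmonoid.closure {(3 : ℤ), 3 + (d : ℤ), 3 + 2 * (d : ℤ)} := by
  set T := AddSubmonoid.closure {(3 : ℤ), 3 + (d : ℤ), 3 + 2 * (d : ℤ)} with hT
  have h3 : (3 : ℤ) ∈ T := AddSubmonoid.subset_closure (by simp)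
  have h3mul : ∀ n : ℕ, 3 * (n : ℤ) ∈ T := fun n => by
    simpa [mul_comm] using T.nsmul_mem h3 n
  have hgen : ∀ y : ℕ, (3 : ℤ) + y * d ∈ T := by
    intro y
    induction y using Nat.strong_induction_on with
    | _ y ih =>
      rcases Nat.lt_or_ge y 3 with hy | hy
      · interval_cases y
        · simpa using h3
        · exact AddSubmonoid.subset_closure (by simp)
        · exact AddSubmonoid.subset_closure (by simp)
      · obtain ⟨m, rfl⟩ : ∃ m, y = m + 3 := ⟨y - 3, by omega⟩
        convert T.add_mem (ih m (by omega)) (h3mul d) using 1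
        push_cast
        ring
  apply le_antisymm
  · refine AddSubmonoid.closure_le.2 ?_
    rintro x (⟨i, -, rfl⟩ | rfl)
    · exact hgen i
    · have ht : t' ≤ -1 := by
        by_contra! h0
        have h1 : 0 ≤ t' := by linarith
        have h2 : s' = 0 := by nlinarith [mul_nonneg (Nat.cast_nonneg (α := ℤ) k) h1]
        rw [h2] at hrow
        omega
      lift s' to ℕ using hs'
      -- `c` is redundant: it equals `(3 + s' d) + 3 (-t' - 1)`.
      have := T.add_mem (hgen s') (h3mul (-t' - 1).toNat)
      rw [Int.toNat_of_nonneg (by linarith)] at this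
      simp only [SetLike.mem_coe]
      convert this using 1
      linarith
  · refine AddSubmonoid.closure_le.2 ?_
    rintro x (rfl | rfl | rfl)
    · exact AddSubmonoid.subset_closure (Or.inl ⟨0, by omega, by simp⟩)
    · exact AddSubmonoid.subset_closure (Or.inl ⟨1, by omega, by simp⟩)
    · exact AddSubmonoid.subset_closure (Or.inl ⟨2, by omega, by simp⟩)

theorem isPseudoSymmetric_closure_three {d : ℕ} (hd : 0 < d) (h : Nat.Coprime 3 d) :
    IsPseudoSymmetric (AddSubmonoid.closure {(3 : ℤ), 3 + (d : ℤ), 3 + 2 * (d : ℤ)}) := by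
  -- The redundant generator `c = 3` gives the semigroup the almost arithmetic form, with `k = 2`.
  rw [← aaSemigroup_three_eq_closure (d := d) (k := 2) (c := 3) (by norm_num) le_rfl
    (s' := 0) (t' := -1) le_rfl (by norm_num) (by norm_num)]
  have hL : LShape (3 : ℕ) d (2 : ℕ) (3 : ℕ) 3 0 1 0 d (-1) := {
    a_pos := by norm_num
    d_pos := by exact_mod_cast hd
    k_two := by norm_num
    c_pos := by norm_num
    coprime := Nat.isCoprime_iff_coprime.2 h
    s'_nonneg := le_rfl
    s'_lt := by norm_num
    p'_nonneg := le_rfl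
    p'_lt := by norm_num
    det := by norm_num
    row := by push_cast; ring
    row' := by norm_num
    pos := by push_cast; positivity
    nonpos := by norm_num }
  exact hL.isPseudoSymmetric_of_eq_three
    (aaSemigroup_isAlmostArithmetic 3 d 2 3 (by norm_num)) rfl (by norm_num) (Or.inl rfl)

theorem coprime_three_of_aaSemigroup_eq {a d k c : ℕ} (h : Nat.Coprime a d)
    (hS : aaSemigroup a d k c =
      AddSubmonoid.closure {(3 : ℤ), 3 + (d : ℤ), 3 + 2 * (d : ℤ)}) : Nat.Coprime 3 d := by
  rw [Nat.Prime.coprime_iff_not_dvd Nat.prime_three]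
  intro h3
  have h3' : (3 : ℤ) ∣ d := by exact_mod_cast h3
  have ha : (a : ℤ) ∈ AddSubmonoid.closure {(3 : ℤ), 3 + (d : ℤ), 3 + 2 * (d : ℤ)} := by
    rw [← hS]
    exact AddSubmonoid.subset_closure (Or.inl ⟨0, by omega, by simp⟩)
  have hdvd : (3 : ℤ) ∣ a := by
    generalize (a : ℤ) = x at ha
    induction ha using AddSubmonoid.closure_induction with
    | mem x hx =>
      rcases hx with rfl | rfl | rfl
      · exact dvd_rfl
      · exact dvd_add dvd_rfl h3'
      · exact dvd_add dvd_rfl (h3'.mul_left 2)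
    | zero => exact dvd_zero 3
    | add x y _ _ hx hy => exact dvd_add hx hy
  have h3a : 3 ∣ a := by exact_mod_cast hdvd
  have := Nat.dvd_gcd h3a h3
  rw [h] at this
  omega

theorem isPseudoSymmetric_of_mul_eq {a d k c : ℕ} (ha : 0 < a) (hd : 0 < d) (hc : 0 < c)
    (hk : 2 ≤ k) (h : Nat.Coprime a d) (heq : (a : ℤ) * (c - 1) = 2 * (c + d)) (hodd : Odd c) :
    IsPseudoSymmetric (aaSemigroup a d k c) := by
  obtain ⟨m, hm⟩ := hodd
  have hcm : (c : ℤ) = 2 * m + 1 := by exact_mod_cast hm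
  have ham : (a : ℤ) * m = c + d := by
    rw [hcm] at heq ⊢
    linarith
  have ha' : (0 : ℤ) < a := by exact_mod_cast ha
  have hd' : (0 : ℤ) < d := by exact_mod_cast hd
  have hk' : (2 : ℤ) ≤ k := by exact_mod_cast hk
  have hc' : (0 : ℤ) < c := by exact_mod_cast hc
  have hm1 : (1 : ℤ) ≤ m := by
    by_contra! h0
    have : (m : ℤ) = 0 := by omega
    rw [this] at ham
    linarith
  have ha3 : (3 : ℤ) ≤ a := by
    by_contra! h0
    nlinarith
  -- The L-shape is written down directly from `a m = c + d`, without locating the index `v`.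
  have hL : LShape a d k c 3 2 (a - 2) (a - 3) (m - 1) (-1) := {
    a_pos := ha'
    d_pos := hd'
    k_two := hk'
    c_pos := hc'
    coprime := Nat.isCoprime_iff_coprime.2 h
    s'_nonneg := by norm_num
    s'_lt := by norm_num
    p'_nonneg := by linarith
    p'_lt := by linarith
    det := by ring
    row := by linear_combination -3 * ham - a * hcm
    row' := by linear_combination -2 * ham - a * hcm
    pos := by nlinarith
    nonpos := by linarith }
  exact hL.isPseudoSymmetric_of_eq_three (aaSemigroup_isAlmostArithmetic a d k c (by omega)) rfl
    (by ring) (Or.inr ⟨rfl, rfl⟩)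

/-! ### Translation into the conditions (a)–(f) -/

theorem exists_eq_of_modEq {k x r : ℤ} (h : x ≡ r [ZMOD k]) : ∃ j, x = k * j + r := by
  obtain ⟨j, hj⟩ := h.symm.dvd
  exact ⟨j, by linarith⟩

theorem modEq_of_eq {k x r : ℤ} (h : ∃ j, x = k * j + r) : x ≡ r [ZMOD k] := by
  obtain ⟨j, rfl⟩ := h
  exact (Int.modEq_iff_dvd.2 ⟨j, by ring⟩).symm

theorem conditions_of_isPseudoSymmetric {a d k c : ℕ} (ha : 0 < a) (hd : 0 < d)
    (hc : 0 < c) (hk : 2 ≤ k) (hcop : Nat.Coprime a d)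
    (hps : IsPseudoSymmetric (aaSemigroup a d k c)) :
    aaSemigroup a d k c = AddSubmonoid.closure {(3 : ℤ), 3 + (d : ℤ), 3 + 2 * (d : ℤ)} ∨
    ((a : ℤ) * ((c : ℤ) - 1) = 2 * ((c : ℤ) + (d : ℤ)) ∧ Odd c) ∨
    (∃ v : ℤ, IsRodsethIndex a d k c v ∧ s a d c v ≡ 3 [ZMOD k] ∧ s a d c (v + 1) = 1 ∧
      P a d c (v + 1) = P a d c v + 1 ∧ R a d k c v = 3) ∨
    (∃ v : ℤ, IsRodsethIndex a d k c v ∧ s a d c v ≡ 1 [ZMOD k] ∧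
      s a d c (v + 1) = 2 * (k : ℤ) - 1 ∧ P a d c (v + 1) = P a d c v + 1 ∧ R a d k c v = 1) ∨
    (0 ≤ lastIndex a d c ∧ s a d c 0 ≡ 2 [ZMOD k] ∧ s a d c 0 = s a d c 1 + 1 ∧
      R a d k c 1 = 1 - 2 * (k : ℚ)) ∨
    (0 ≤ lastIndex a d c ∧ s a d c 0 ≡ 2 [ZMOD k] ∧ s a d c 0 = s a d c 1 + 3 ∧
      R a d k c 1 = -1) := by
  have hS := aaSemigroup_isAlmostArithmetic a d k c (by omega)
  obtain ⟨v, hv⟩ := exists_isRodsethIndex (d := d) (k := k) (c := c) ha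
  obtain ⟨hv1, hv2, hR', hR⟩ := id hv
  obtain ⟨t, t', hRv, hRv', row, row', -, -, -, -, det, hL⟩ :=
    lshape_of_index ha hd hc hk hcop hv1 hv2
  rw [hRv] at hR
  rw [hRv'] at hR'
  have hL := hL (by exact_mod_cast hR) (by exact_mod_cast hR')
  rcases hL.shape_of_isPseudoSymmetric hS hps with ⟨h1, h2, h3⟩ | ⟨h1, h2, h3, h4⟩ |
    ⟨hj, h2, h3, h4⟩ | ⟨hj, h2, h3, h4⟩ | ⟨hj, h2, h3, h4⟩ | ⟨hj, h2, h3, h4⟩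
  · left
    rw [h1, h2, h3] at det
    have ha3 : a = 3 := by omega
    subst ha3
    refine aaSemigroup_three_eq_closure hc hk hL.s'_nonneg ?_ hL.nonpos
    rw [h2] at row'
    push_cast at row'
    linarith
  · right; left
    rw [h1, h2] at det
    rw [h1] at row
    rw [h2, h4] at row'
    have hp : P a d c v = a - 3 := by linarith
    rw [h3, hp] at row'
    rw [hp] at row
    have heq : (a : ℤ) * (c - 1) = 2 * (c + d) := by linear_combination -row'
    -- If `c` were even, `heq` would make `a` even and `row` would make `d` even.
    refine ⟨heq, ?_⟩
    by_contra hce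
    rw [Nat.not_odd_iff_even] at hce
    have hcz : Even (c : ℤ) := by exact_mod_cast hce
    have hae : Even (a : ℤ) := by
      have : Even ((a : ℤ) * (c - 1)) := by rw [heq]; exact even_two_mul _
      rcases Int.even_mul.1 this with h | h
      · exact h
      · exfalso
        rw [Int.even_sub_one] at h
        exact h hcz
    have hde : Even (d : ℤ) := by
      have : Even ((d : ℤ) * 3) := by
        rw [show (d : ℤ) * 3 = c * (a - 3) + a * t by linarith]
        exact (hcz.mul_right _).add (hae.mul_right _)
      rcases Int.even_mul.1 this with h | h
      · exact h
      · exact absurd h (by decide)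
    have h2a : 2 ∣ a := by exact_mod_cast hae.two_dvd
    have h2d : 2 ∣ d := by exact_mod_cast hde.two_dvd
    have := Nat.dvd_gcd h2a h2d
    rw [hcop] at this
    omega
  · right; right; left
    exact ⟨v, hv, modEq_of_eq hj, h2, h3, by rw [hRv, h4]; norm_num⟩
  · right; right; right; left
    exact ⟨v, hv, modEq_of_eq hj, h2, h3, by rw [hRv, h4]; norm_num⟩
  · right; right; right; right; left
    obtain rfl := eq_zero_of_P_eq_one ha hv1 hv2 h2
    rw [zero_add] at h3 h4 hRv'
    exact ⟨hv2, modEq_of_eq hj, h3, by rw [hRv', h4]; push_cast; ring⟩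
  · right; right; right; right; right
    obtain rfl := eq_zero_of_P_eq_one ha hv1 hv2 h2
    rw [zero_add] at h3 h4 hRv'
    exact ⟨hv2, modEq_of_eq hj, h3, by rw [hRv', h4]; norm_num⟩

theorem isPseudoSymmetric_of_index {a d k c : ℕ} (ha : 0 < a) (hd : 0 < d)
    (hc : 0 < c) (hk : 2 ≤ k) (hcop : Nat.Coprime a d) {v : ℤ} (hv : IsRodsethIndex a d k c v)
    (hP : P a d c (v + 1) = P a d c v + 1)
    (hs : s a d c v ≡ 3 [ZMOD k] ∧ s a d c (v + 1) = 1 ∧ R a d k c v = 3 ∨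
      s a d c v ≡ 1 [ZMOD k] ∧ s a d c (v + 1) = 2 * (k : ℤ) - 1 ∧ R a d k c v = 1) :
    IsPseudoSymmetric (aaSemigroup a d k c) := by
  have hS := aaSemigroup_isAlmostArithmetic a d k c (by omega)
  obtain ⟨hv1, hv2, hR', hR⟩ := hv
  obtain ⟨t, t', hRv, hRv', -, -, -, -, -, -, -, hL⟩ := lshape_of_index ha hd hc hk hcop hv1 hv2
  rw [hRv'] at hR'
  rw [hRv] at hs hR
  have hL := hL (by exact_mod_cast hR) (by exact_mod_cast hR')
  rcases hs with ⟨h1, h2, h3⟩ | ⟨h1, h2, h3⟩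
  · obtain ⟨j, hj⟩ := exists_eq_of_modEq h1
    exact hL.isPseudoSymmetric_of_s'_eq_one hS hj h2 hP (by exact_mod_cast h3)
  · obtain ⟨j, hj⟩ := exists_eq_of_modEq h1
    exact hL.isPseudoSymmetric_of_s'_eq_two_mul_sub_one hS hj h2 hP (by exact_mod_cast h3)

/-- Cases (e) and (f) do not presuppose `v = 0`, so the positivity of `R_0` has to be derived before
an L-shape is available. -/
theorem isPseudoSymmetric_of_index_zero {a d k c : ℕ} (ha : 0 < a) (hd : 0 < d)
    (hc : 0 < c) (hk : 2 ≤ k) (hcop : Nat.Coprime a d) (hv : 0 ≤ lastIndex a d c)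
    (hmod : s a d c 0 ≡ 2 [ZMOD k])
    (hs : s a d c 0 = s a d c 1 + 1 ∧ R a d k c 1 = 1 - 2 * (k : ℚ) ∨
      s a d c 0 = s a d c 1 + 3 ∧ R a d k c 1 = -1) :
    IsPseudoSymmetric (aaSemigroup a d k c) := by
  have hS := aaSemigroup_isAlmostArithmetic a d k c (by omega)
  obtain ⟨t, t', -, hR', row, row', hs1, hs0, -, hp, -, hL⟩ :=
    lshape_of_index ha hd hc hk hcop (by norm_num) hv
  rw [zero_add] at hR' row' hs1 hs0 hp hL
  have hP : P a d c 0 = 1 := by simp [P, pSeq]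
  rw [hP] at row hp hL
  have ha' : (0 : ℤ) < a := by exact_mod_cast ha
  have hd' : (0 : ℤ) < d := by exact_mod_cast hd
  have hk' : (2 : ℤ) ≤ k := by exact_mod_cast hk
  have hc' : (0 : ℤ) < c := by exact_mod_cast hc
  have hk0 : (k : ℤ) ≠ 0 := by linarith
  obtain ⟨j, hj⟩ := exists_eq_of_modEq hmod
  have hj0 : 0 ≤ j := by
    by_contra! h0
    nlinarith
  have hcp : (c : ℤ) ≤ c * (P a d c 1 - 1) := le_mul_of_one_le_right hc'.le (by linarith)
  rcases hs with ⟨h1, h2⟩ | ⟨h1, h2⟩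
  · have hkt : (k : ℤ) * t' + s a d c 1 = 1 - 2 * k := by
      rw [hR'] at h2
      exact_mod_cast h2
    have ht' : t' = -j - 2 := mul_left_cancel₀ hk0 (by linarith)
    have hdiff : (d : ℤ) = a * (t - t') - c * (P a d c 1 - 1) := by
      rw [h1] at row
      linear_combination row - row'
    -- If `R_0 ≤ 0`, only `t = -j - 1 = t' + 1` remains. Then `d ≤ a - c`, and `row` makes `d s₀`
    -- negative.
    have hpos : 0 < k * t + s a d c 0 := by
      by_contra! hle
      have h3 : 0 < t - t' := by
        by_contra! h0
        nlinarith
      have h4 : t < -j := by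
        by_contra! h0
        nlinarith
      have h5 : t = -j - 1 := by omega
      rw [h5, ht'] at hdiff
      rw [h5] at row
      nlinarith [mul_nonneg ha'.le hj0, mul_nonneg hd'.le (hs1.trans hs0.le)]
    exact (hL hpos (by linarith)).isPseudoSymmetric_of_eq_add_one hS hj h1 rfl hkt
  · have hkt : (k : ℤ) * t' + s a d c 1 = -1 := by
      rw [hR'] at h2
      exact_mod_cast h2
    have ht' : t' = -j := mul_left_cancel₀ hk0 (by linarith)
    have hdiff : 3 * (d : ℤ) = a * (t - t') - c * (P a d c 1 - 1) := by
      rw [h1] at row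
      linear_combination row - row'
    have hpos : 0 < k * t + s a d c 0 := by
      have h3 : 0 < t - t' := by
        by_contra! h0
        nlinarith
      nlinarith
    exact (hL hpos (by linarith)).isPseudoSymmetric_of_eq_add_three hS hj h1 rfl hkt

end AASemigroup

theorem theorem4p5 (a d k c : ℕ) (ha : 0 < a) (hd : 0 < d) (hc : 0 < c) (hk : 2 ≤ k) :
    AASemigroup.IsPseudoSymmetric (AASemigroup.aaSemigroup a d k c) ↔
      Nat.gcd a d = 1 ∧
      ( -- (a)
        AASemigroup.aaSemigroup a d k c =
          AddSubmonoid.closure {(3 : ℤ), 3 + (d : ℤ), 3 + 2 * (d : ℤ)} ∨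
        -- (b)
        ((a : ℤ) * ((c : ℤ) - 1) = 2 * ((c : ℤ) + (d : ℤ)) ∧ Odd c) ∨
        -- (c)
        (∃ v : ℤ, AASemigroup.IsRodsethIndex a d k c v ∧
          AASemigroup.s a d c v ≡ 3 [ZMOD k] ∧
          AASemigroup.s a d c (v + 1) = 1 ∧
          AASemigroup.P a d c (v + 1) = AASemigroup.P a d c v + 1 ∧
          AASemigroup.R a d k c v = 3) ∨
        -- (d)
        (∃ v : ℤ, AASemigroup.IsRodsethIndex a d k c v ∧
          AASemigroup.s a d c v ≡ 1 [ZMOD k] ∧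
          AASemigroup.s a d c (v + 1) = 2 * (k : ℤ) - 1 ∧
          AASemigroup.P a d c (v + 1) = AASemigroup.P a d c v + 1 ∧
          AASemigroup.R a d k c v = 1) ∨
        -- (e), where `0 ≤ m` says that the index 1 occurs
        (0 ≤ AASemigroup.lastIndex a d c ∧
          AASemigroup.s a d c 0 ≡ 2 [ZMOD k] ∧
          AASemigroup.s a d c 0 = AASemigroup.s a d c 1 + 1 ∧
          AASemigroup.R a d k c 1 = 1 - 2 * (k : ℚ)) ∨
        -- (f)
        (0 ≤ AASemigroup.lastIndex a d c ∧
          AASemigroup.s a d c 0 ≡ 2 [ZMOD k] ∧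
          AASemigroup.s a d c 0 = AASemigroup.s a d c 1 + 3 ∧
          AASemigroup.R a d k c 1 = -1)) := by
  constructor
  · intro hps
    have hcop : Nat.gcd a d = 1 := by
      have := hps.eq_one_of_dvd (e := (Nat.gcd a d : ℤ))
        (AASemigroup.aaSemigroup_isAlmostArithmetic a d k c (by omega)) (by exact_mod_cast hc)
        (by exact_mod_cast Nat.gcd_pos_of_pos_left d ha)
        (by exact_mod_cast Nat.gcd_dvd_left a d) (by exact_mod_cast Nat.gcd_dvd_right a d)
      exact_mod_cast this
    exact ⟨hcop, AASemigroup.conditions_of_isPseudoSymmetric ha hd hc hk hcop hps⟩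
  · rintro ⟨hcop, hS | ⟨heq, hodd⟩ | ⟨v, hv, h1, h2, h3, h4⟩ | ⟨v, hv, h1, h2, h3, h4⟩ |
      ⟨hm, h1, h2, h3⟩ | ⟨hm, h1, h2, h3⟩⟩
    · rw [hS]
      exact AASemigroup.isPseudoSymmetric_closure_three hd
        (AASemigroup.coprime_three_of_aaSemigroup_eq hcop hS)
    · exact AASemigroup.isPseudoSymmetric_of_mul_eq ha hd hc hk hcop heq hodd
    · exact AASemigroup.isPseudoSymmetric_of_index ha hd hc hk hcop hv h3 (Or.inl ⟨h1, h2, h4⟩)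
    · exact AASemigroup.isPseudoSymmetric_of_index ha hd hc hk hcop hv h3 (Or.inr ⟨h1, h2, h4⟩)
    · exact AASemigroup.isPseudoSymmetric_of_index_zero ha hd hc hk hcop hm h1 (Or.inl ⟨h2, h3⟩)
    · exact AASemigroup.isPseudoSymmetric_of_index_zero ha hd hc hk hcop hm h1 (Or.inr ⟨h2, h3⟩)
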